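/- **Notation.** Let $\{0,1\}^*$ be the binary rooted tree (finite strings, each $v$ joined to $v0$ and $v1$), and let $\omega=\omega(1)\omega(2)\cdots\in\{0,1,2\}^{\mathbb N_+}$ with shift $\sigma$. The Grigorchuk group $G_\omega$ is the group of tree automorphisms generated by $a,b_\omega,c_\omega,d_\omega$, where $a$ flips the first letter of a string and, for $x\in\{0,1\}$, $v\in\{0,1\}^*$, $$b_\omega(0xv)=0\,\varepsilon_{2\omega(1)}(x)\,v,\quad c_\omega(0xv)=0\,\varepsilon_{1\omega(1)}(x)\,v,\quad d_\omega(0xv)=0\,\varepsilon_{0\omega(1)}(x)\,v,$$ $$b_\omega(1v)=1\,b_{\sigma\omega}(v),\quad c_\omega(1v)=1\,c_{\sigma\omega}(v),\quad d_\omega(1v)=1\,d_{\sigma\omega}(v)$$ (strings too short for a rule to apply are fixed). Here $\varepsilon_{ij}$ is the flip of $\{0,1\}$ if $i\ne j$ and the identity if $i=j$. $G_\omega$ acts on infinite strings; put $\rho=111\cdots$. The Schreier graph $\Gamma_\omega$ has vertex set $G_\omega\rho$ and a non-oriented edge labelled $s$ between $\gamma$ and $s\gamma$ for every $s\in\{a,b_\omega,c_\omega,d_\omega\}$;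 $\tilde\Gamma_\omega$ is $\Gamma_\omega$ with the loops at $\rho$ erased. For a homeomorphism $\varphi$ of $X$, the topological full group $[[\varphi]]$ is the group of homeomorphisms $g$ of $X$ for which there is a continuous $n:X\to\mathbb Z$ with $g(x)=\varphi^{n(x)}(x)$ for all $x$. A system $(X,\varphi)$ is minimal if $X\neq\varnothing$ and every orbit is dense; it is a Cantor minimal system if moreover $X$ is homeomorphic to the Cantor set. A subshift is a closed shift-invariant subset of $A^{\mathbb Z}$, $A$ finite, with the shift map. Consider the four labelled graphs on two vertices (left and right): $\Theta$, a single edge labelled $a$; and $\Lambda_0,\Lambda_1,\Lambda_2$, consisting of a double edge labelled by $\{b,c\}$, $\{b,d\}$, $\{c,d\}$ respectively, together with a loop at each vertex labelled by the remaining letter $d$, $c$, $b$ respectively. A sequence $x\in\{\Theta,\Lambda_0,\Lambda_1,\Lambda_2\}^{\mathbb Z}$ is identified with the labelled graph on $\mathbb Z$ in which $n$ and $n+1$ are joined by the block $x_n$; the shift is $(\varphi x)_n=x_{n+1}$. Let $X_\omega$ be the set of all such $x$ for which every finite connected labelled subgraph of $x$ is isomorphic to a subgraph of $\tilde\Gamma_\omega$,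 and let $\varphi_\omega$ be the restriction of $\varphi$ to $X_\omega$. **Theorem.** 1. For every $\omega\in\{0,1,2\}^{\mathbb N_+}$ there are an infinite minimal subshift and an injective homomorphism from $G_\omega$ into its topological full group. 2. If $\omega$ is eventually constant, then $G_\omega$ embeds into $\mathbb Z^n\rtimes S_n$ for some $n$ ($S_n$ permuting the coordinates). For every Cantor minimal system $(X,\varphi)$ and every $n$, the group $\mathbb Z^n\rtimes S_n$ embeds into $[[\varphi]]$; hence, for $\omega$ eventually constant, $G_\omega$ embeds into $[[\varphi]]$. 3. If $\omega$ is not eventually constant, then $X_\omega$ is an infinite minimal subshift. There is $y\in\{\Theta,\Lambda_0,\Lambda_1,\Lambda_2\}^{\mathbb Z}$ whose half-line $\{0,1,2,\dots\}$ (with the blocks $y_0,y_1,\dots$) is isomorphic as a labelled graph to $\tilde\Gamma_\omega$, with $0$ corresponding to $\rho$, and for every such $y$ the set $X_\omega$ is the set of cluster points of $(\varphi^n(y))_{n\ge 0}$. For every $x\in X_\omega$ and every label $f\in\{a,b,c,d\}$ there is exactly one $m\in\mathbb Z$ such that $x$ has an edge labelled $f$ between $0$ and $m$. There is an injective homomorphism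 $\iota:G_\omega\to[[\varphi_\omega]]$ such that, for each generator $f\in\{a,b_\omega,c_\omega,d_\omega\}$ and each $x\in X_\omega$, $\iota(f)$ sends $x$ to $\varphi_\omega(x)$, $\varphi_\omega^{-1}(x)$ or $x$ according to whether the edge of $x$ labelled $f$ at the vertex $0$ joins $0$ to $1$, to $-1$, or is a loop. -/

import Mathlib

open Topology

namespace GrigorchukFullGroup

/-! ### The binary rooted tree and the Grigorchuk groups -/

/-- The binary rooted tree: vertices are the finite binary strings (`false` is the digit 0, `true`
is the digit 1); a string is joined to its one-letter extensions on the right. -/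
def tree : SimpleGraph (List Bool) where
  Adj v w := (∃ x, w = v ++ [x]) ∨ (∃ x, v = w ++ [x])
  symm := ⟨fun _ _ h => h.symm⟩
  loopless := ⟨fun v h => by
    rcases h with ⟨x, h⟩ | ⟨x, h⟩ <;> simpa using congrArg List.length h⟩

/-- Tree automorphisms, a group under composition. -/
abbrev TreeAut := tree ≃g tree

/-- An involution of the set of strings that is compatible with one-letter extensions is a
tree automorphism. -/
def autOfInvolutive (f : List Bool → List Bool) (hf : Function.Involutive f)
    (h : ∀ v x, ∃ y, f (v ++ [x]) = f v ++ [y]) : TreeAut where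
  toEquiv := hf.toPerm
  map_rel_iff' := by
    have key : ∀ v w, tree.Adj v w → tree.Adj (f v) (f w) := by
      rintro v w (⟨x, rfl⟩ | ⟨x, rfl⟩)
      · exact Or.inl (h v x)
      · exact Or.inr (h w x)
    intro v w
    refine ⟨fun hvw => ?_, key v w⟩
    have h2 := key _ _ hvw
    rwa [Function.Involutive.coe_toPerm, hf v, hf w] at h2

/-- The rule `a (x v) = ε(x) v`. -/
def aFun : List Bool → List Bool
  | [] => []
  | x :: v => (!x) :: v

/-- A parameter sequence `ω ∈ {0,1,2}^{ℕ₊}`; here `ω n` is the `(n+1)`-st term. -/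
abbrev Omega := ℕ → Fin 3

/-- The shift `σ` on parameter sequences. -/
def Omega.shift (ω : Omega) : Omega := fun n => ω (n + 1)

/-- The rule `t (0 x v) = 0 ε_{k ω(1)}(x) v`, `t (1 v) = 1 t_{σ ω}(v)`, where `ε_{ij}` is the
flip if `i ≠ j` and the identity if `i = j`. -/
def tFun (k : Fin 3) : Omega → List Bool → List Bool
  | _, [] => []
  | _, [false] => [false]
  | ω, false :: x :: v => false :: (if k = ω 0 then x else !x) :: v
  | ω, true :: v => true :: tFun k ω.shift v

theorem aFun_involutive : Function.Involutive aFun := by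
  intro v
  cases v <;> simp [aFun]

theorem aFun_append (v : List Bool) (x : Bool) : ∃ y, aFun (v ++ [x]) = aFun v ++ [y] := by
  cases v <;> simp [aFun]

theorem tFun_involutive (k : Fin 3) (ω : Omega) : Function.Involutive (tFun k ω) := by
  intro v
  induction v generalizing ω with
  | nil => simp [tFun]
  | cons y v ih =>
    cases y
    · cases v with
      | nil => simp [tFun]
      | cons x v => by_cases h : k = ω 0 <;> simp [tFun, h]
    · simp [tFun, ih]

theorem tFun_append (k : Fin 3) (ω : Omega) (v : List Bool) (x : Bool) :
    ∃ y, tFun k ω (v ++ [x]) = tFun k ω v ++ [y] := by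
  induction v generalizing ω with
  | nil => cases x <;> simp [tFun]
  | cons y v ih =>
    cases y
    · cases v with
      | nil => simp [tFun]
      | cons z v => simp [tFun]
    · obtain ⟨z, hz⟩ := ih ω.shift
      exact ⟨z, by simp [tFun, hz]⟩

/-- The four labels (names of the generators). -/
inductive Gen
  | a | b | c | d

/-- The four generating automorphisms `a, b_ω, c_ω, d_ω`. -/
def genAut (ω : Omega) : Gen → TreeAut
  | .a => autOfInvolutive aFun aFun_involutive aFun_append
  | .b => autOfInvolutive (tFun 2 ω) (tFun_involutive 2 ω) (tFun_append 2 ω)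
  | .c => autOfInvolutive (tFun 1 ω) (tFun_involutive 1 ω) (tFun_append 1 ω)
  | .d => autOfInvolutive (tFun 0 ω) (tFun_involutive 0 ω) (tFun_append 0 ω)

/-- The Grigorchuk group `G_ω`. -/
def grigorchukGroup (ω : Omega) : Subgroup TreeAut :=
  Subgroup.closure (Set.range (genAut ω))

/-- The generators as elements of `G_ω`. -/
def gen (ω : Omega) (s : Gen) : grigorchukGroup ω :=
  ⟨genAut ω s, Subgroup.subset_closure (Set.mem_range_self s)⟩

/-- `ω` is eventually constant. -/
def EventuallyConstant (ω : Omega) : Prop := ∃ N, ∀ n, N ≤ n → ω n = ω N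

/-! ### The labelled Schreier graph of the orbit of `111…` -/

/-- The action of a tree automorphism on the boundary of the tree, i.e. on right-infinite strings:
the image of `γ` is the string whose prefixes are the images of the prefixes of `γ`. -/
def boundaryAct (g : TreeAut) (γ : ℕ → Bool) : ℕ → Bool :=
  fun n => (g (List.ofFn fun i : Fin (n + 1) => γ i)).getD n false

/-- The string `ρ = 111…`. -/
def rho : ℕ → Bool := fun _ => true

/-- The orbit `G_ω ρ`. -/
def orbitRho (ω : Omega) : Set (ℕ → Bool) :=
  {γ | ∃ g ∈ grigorchukGroup ω, boundaryAct g rho = γ}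

/-- Non-oriented graphs with edges labelled by `Gen`; loops and multiple edges with different
labels are allowed. `Adj s u v` means that there is an edge labelled `s` between `u` and `v`. -/
structure LabelledGraph (V : Type*) where
  Adj : Gen → V → V → Prop
  symm : ∀ s u v, Adj s u v → Adj s v u

namespace LabelledGraph

/-- Connectedness. -/
def Connected {V : Type*} (G : LabelledGraph V) : Prop :=
  Nonempty V ∧ ∀ u v, Relation.ReflTransGen (fun x y => ∃ s, G.Adj s x y) u v

/-- `P` is isomorphic to a labelled subgraph of `G`. -/
def AppearsIn {U V : Type*} (P : LabelledGraph U) (G : LabelledGraph V) : Prop :=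
  ∃ f : U → V, Function.Injective f ∧ ∀ s u v, P.Adj s u v → G.Adj s (f u) (f v)

end LabelledGraph

/-- The Schreier graph `Γ_ω` of the action of `G_ω` on the orbit of `ρ`. -/
def schreierGraph (ω : Omega) : LabelledGraph (orbitRho ω) where
  Adj s γ η := boundaryAct (genAut ω s) γ = η ∨ boundaryAct (genAut ω s) η = γ
  symm _ _ _ h := h.symm

/-- The graph obtained from `Γ_ω` by erasing the loops at `ρ`. -/
def prunedSchreierGraph (ω : Omega) : LabelledGraph (orbitRho ω) where
  Adj s γ η := (schreierGraph ω).Adj s γ η ∧ ¬ (γ.1 = rho ∧ η.1 = rho)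
  symm s γ η h := ⟨(schreierGraph ω).symm s γ η h.1, fun h2 => h.2 h2.symm⟩

/-! ### Homeomorphisms, topological full groups, subshifts -/

/-- A dynamical system on a nonempty space is minimal if every orbit is dense. -/
def IsMinimalSystem {X : Type*} [TopologicalSpace X] (φ : X ≃ₜ X) : Prop :=
  Nonempty X ∧ ∀ x, Dense (Set.range fun n : ℤ => (φ ^ n) x)

/-- A Cantor minimal system. -/
def IsCantorMinimal {X : Type*} [TopologicalSpace X] (φ : X ≃ₜ X) : Prop :=
  Nonempty (X ≃ₜ (ℕ → Bool)) ∧ IsMinimalSystem φ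

/-- The topological full group `[[φ]]`. -/
def fullGroup {X : Type*} [TopologicalSpace X] (φ : X ≃ₜ X) : Subgroup (X ≃ₜ X) where
  carrier := {g | ∃ n : X → ℤ, Continuous n ∧ ∀ x, g x = (φ ^ n x) x}
  one_mem' := ⟨fun _ => 0, continuous_const, fun x => by simp⟩
  mul_mem' := by
    rintro g h ⟨n, hn, hg⟩ ⟨m, hm, hh⟩
    refine ⟨fun x => n (h x) + m x, (hn.comp h.continuous).add hm, fun x => ?_⟩
    rw [zpow_add]
    change g (h x) = (φ ^ n (h x)) ((φ ^ m x) x)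
    rw [hg, ← hh]
  inv_mem' := by
    rintro g ⟨n, hn, hg⟩
    refine ⟨fun x => -n (g⁻¹ x), (hn.comp (g⁻¹ : X ≃ₜ X).continuous).neg, fun x => ?_⟩
    have h1 : g (g⁻¹ x) = x := g.apply_symm_apply x
    have h2 := hg (g⁻¹ x)
    rw [h1] at h2
    rw [zpow_neg]
    change _ = (φ ^ n (g⁻¹ x)).symm x
    rw [Homeomorph.eq_symm_apply]
    exact h2.symm

/-- The shift homeomorphism of the full shift `A^ℤ`: `(shift x) n = x (n + 1)`. -/
def shift (A : Type*) [TopologicalSpace A] : (ℤ → A) ≃ₜ (ℤ → A) where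
  toFun x n := x (n + 1)
  invFun x n := x (n - 1)
  left_inv x := by ext n; simp
  right_inv x := by ext n; simp
  continuous_toFun := by fun_prop
  continuous_invFun := by fun_prop

/-- Subshifts: closed, shift-invariant subsets of `A^ℤ` (the alphabet `A` will be finite and
discrete). -/
structure Subshift (A : Type*) [TopologicalSpace A] where
  carrier : Set (ℤ → A)
  isClosed : IsClosed carrier
  shift_mem_iff : ∀ x, x ∈ carrier ↔ shift A x ∈ carrier

/-- The restriction of the shift to a subshift. -/
def Subshift.map {A : Type*} [TopologicalSpace A] (Y : Subshift A) : Y.carrier ≃ₜ Y.carrier :=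
  (shift A).subtype Y.shift_mem_iff

/-! ### The subshift attached to a parameter sequence -/

/-- The four two-vertex building blocks: `theta` is a single edge labelled `a`; `lam 0`, `lam 1`,
`lam 2` are double edges labelled `b,c`, resp. `b,d`, resp. `c,d`, with a loop at each of
the two vertices labelled by the remaining letter `d`, resp. `c`, resp. `b`. -/
inductive Block
  | theta
  | lam (i : Fin 3)
  deriving Fintype

instance : TopologicalSpace Block := ⊥

instance : DiscreteTopology Block := ⟨rfl⟩

/-- The label of the loops of `lam i`. -/
def loopLabel : Fin 3 → Gen
  | 0 => .d
  | 1 => .c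
  | 2 => .b

/-- The block has an edge labelled `s` between its two vertices. -/
def Block.Joins : Block → Gen → Prop
  | .theta, s => s = .a
  | .lam i, s => s ≠ .a ∧ s ≠ loopLabel i

/-- The block has loops labelled `s` at its two vertices. -/
def Block.Loops : Block → Gen → Prop
  | .theta, _ => False
  | .lam i, s => s = loopLabel i

/-- The graph on the integers obtained by gluing, for every `n ∈ I`, the block `x n` between the
vertices `n` and `n + 1`. -/
def blockGraphOn (I : Set ℤ) (x : ℤ → Block) : LabelledGraph ℤ where
  Adj s i j := ∃ n ∈ I,
    ((x n).Joins s ∧ ((i = n ∧ j = n + 1) ∨ (i = n + 1 ∧ j = n))) ∨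
    ((x n).Loops s ∧ i = j ∧ (i = n ∨ i = n + 1))
  symm := by
    rintro s i j ⟨n, hn, ⟨h, h2⟩ | ⟨h, rfl, h2⟩⟩
    · exact ⟨n, hn, Or.inl ⟨h, h2.symm.imp And.symm And.symm⟩⟩
    · exact ⟨n, hn, Or.inr ⟨h, rfl, h2⟩⟩

/-- The labelled graph on `ℤ` encoded by a bi-infinite sequence of blocks. -/
def blockGraph (x : ℤ → Block) : LabelledGraph ℤ := blockGraphOn Set.univ x

/-- The set `X_ω`: all `x` such that every finite pattern (finite connected labelled graph, up to
isomorphism) of the graph of `x` appears in `Γ_ω` with the loops at `ρ` erased. -/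
def subshiftSet (ω : Omega) : Set (ℤ → Block) :=
  {x | ∀ (k : ℕ) (P : LabelledGraph (Fin k)), P.Connected →
    P.AppearsIn (blockGraph x) → P.AppearsIn (prunedSchreierGraph ω)}

/-- On the half-line `{0, 1, 2, …}` the blocks of `y` form a copy of `Γ_ω` with the loops at `ρ`
erased, the vertex `0` corresponding to `ρ`. -/
def ExtendsSchreierGraph (ω : Omega) (y : ℤ → Block) : Prop :=
  ∃ f : ℕ ≃ orbitRho ω, (f 0).1 = rho ∧
    ∀ s (i j : ℕ), (blockGraphOn (Set.Ici 0) y).Adj s i j ↔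
      (prunedSchreierGraph ω).Adj s (f i) (f j)

/-- The group `ℤⁿ ⋊ Sₙ`, the symmetric group permuting the coordinates. -/
abbrev IntWreath (n : ℕ) : Type :=
  (Fin n → Multiplicative ℤ) ⋊[mulAutArrow] Equiv.Perm (Fin n)

end GrigorchukFullGroup

open GrigorchukFullGroup

namespace GrigorchukFullGroup

/-! Label the strings in the orbit of `ρ` by the integers `n ≥ 0` of which they are the complemented
Gray codes. The generators then become moves along a line of blocks: `Θ` at even positions, and at
odd positions `n` the block `Λ` of index `ω (v₂ ((n + 1) / 2))`. The code does not distinguish `n`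
from `-1 - n`, so the Schreier graph is this line folded at the block `-1`, whose index is free;
`toeplitz ω i` puts `lam i` into that hole. A word moves vertices by a bounded amount that depends
only on a bounded window (`vertexAct_local`), and it is trivial in `G_ω` exactly when it fixes all
vertices far to the right (`treeAct_eq_one_iff`).

Away from the hole every window recurs with some period `2 ^ k`. Hence the sequences whose windows
occur far to the right are all alike in their windows (`toeplitzSet_recurrent`), and they form `X_ω`
(`subshiftSet_eq`). If `ω` takes two values infinitely often, both fillings of the hole lie in `X_ω`
and differ in one place, so `X_ω` is infinite (`toeplitzSet_infinite`) and the shift acts freely.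
Words act on `X_ω` by elements of the full group; locality in one direction and freeness in the
other show that the kernel is that of `G_ω` (`treeAct_eq_one_iff_subshiftAct`).

If `ω` is eventually constant, filling the hole with the final value makes the line periodic. A
permutation of `ℤ` commuting with translation by `M` is an element of `ℤᴹ ⋊ S_M`
(`exists_towerAct_eq`). This group acts on a tower over a clopen set `U` with disjoint images:
permutations exchange the floors and the copies of `ℤ` act by first return to `U`
(`IsMinimalSystem.exists_intWreath_embedding`). For the first assertion the target is then the
subshift of some other, not eventually constant, parameter. -/

/-! ### The Toeplitz sequence of blocks -/

/-- The label `ω (v₂ q)` attached to a nonzero integer `q`; the value at `0` is `i`. -/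
def dyadicLabel (ω : Omega) (i : Fin 3) (q : ℤ) : Fin 3 :=
  if q = 0 then i else ω (padicValInt 2 q)

/-- The Toeplitz sequence of blocks with the hole at `-1` filled with `lam i`. -/
def toeplitz (ω : Omega) (i : Fin 3) (n : ℤ) : Block :=
  if n % 2 = 0 then .theta else .lam (dyadicLabel ω i ((n + 1) / 2))

theorem padicValInt_eq_of_forall_dvd_iff {q r : ℤ} (hq : q ≠ 0) (hr : r ≠ 0)
    (h : ∀ k : ℕ, (2 : ℤ) ^ k ∣ q ↔ (2 : ℤ) ^ k ∣ r) : padicValInt 2 q = padicValInt 2 r := by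
  have key : ∀ {q r : ℤ}, q ≠ 0 → r ≠ 0 → (∀ k : ℕ, (2 : ℤ) ^ k ∣ q ↔ (2 : ℤ) ^ k ∣ r) →
      padicValInt 2 q ≤ padicValInt 2 r := by
    intro q r hq hr h
    have h1 : ((2 : ℕ) : ℤ) ^ (padicValInt 2 q) ∣ r := (h _).1 (padicValInt_dvd q)
    exact ((padicValInt_dvd_iff _ r).1 h1).resolve_left hr
  exact le_antisymm (key hq hr h) (key hr hq fun k => (h k).symm)

theorem dyadicLabel_neg (ω : Omega) (i : Fin 3) (q : ℤ) :
    dyadicLabel ω i (-q) = dyadicLabel ω i q := by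
  unfold dyadicLabel
  by_cases h : q = 0
  · simp [h]
  · rw [if_neg h, if_neg (neg_ne_zero.2 h),
      padicValInt_eq_of_forall_dvd_iff (neg_ne_zero.2 h) h fun k => dvd_neg]

theorem dyadicLabel_add (ω : Omega) (i j : Fin 3) {q r : ℤ} {K : ℕ} (hq : ¬ (2 : ℤ) ^ K ∣ q)
    (hr : (2 : ℤ) ^ K ∣ r) : dyadicLabel ω i (q + r) = dyadicLabel ω j q := by
  have h0 : q ≠ 0 := by rintro rfl; exact hq (dvd_zero _)
  have hK : ¬ (2 : ℤ) ^ K ∣ q + r := by rwa [dvd_add_left hr]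
  have h1 : q + r ≠ 0 := by intro h; rw [h] at hK; exact hK (dvd_zero _)
  unfold dyadicLabel
  rw [if_neg h0, if_neg h1, padicValInt_eq_of_forall_dvd_iff h1 h0]
  intro k
  rcases le_total k K with hk | hk
  · exact dvd_add_left ((pow_dvd_pow _ hk).trans hr)
  · exact ⟨fun h => (hK ((pow_dvd_pow _ hk).trans h)).elim,
      fun h => (hq ((pow_dvd_pow _ hk).trans h)).elim⟩

theorem dyadicLabel_of_odd (ω : Omega) (i : Fin 3) {q : ℤ} (hq : q % 2 = 1) :
    dyadicLabel ω i q = ω 0 := by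
  have h0 : q ≠ 0 := by rintro rfl; simp at hq
  have h : padicValInt 2 q = 0 := by
    apply padicValInt.eq_zero_of_not_dvd
    omega
  rw [dyadicLabel, if_neg h0, h]

theorem dyadicLabel_two_mul (ω : Omega) (i : Fin 3) (q : ℤ) :
    dyadicLabel ω i (2 * q) = dyadicLabel ω.shift i q := by
  unfold dyadicLabel
  by_cases h : q = 0
  · simp [h]
  · have h2 : padicValInt 2 (2 * q) = padicValInt 2 q + 1 := by
      rw [padicValInt.mul two_ne_zero h, add_comm]
      congr 1
      exact padicValInt_self
    rw [if_neg h, if_neg (by omega), h2]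
    rfl

theorem dyadicLabel_two_pow (ω : Omega) (i : Fin 3) (K : ℕ) :
    dyadicLabel ω i (2 ^ K) = ω K := by
  induction K generalizing ω with
  | zero => exact dyadicLabel_of_odd ω i rfl
  | succ K ih => rw [pow_succ', dyadicLabel_two_mul, ih]; rfl

theorem dyadicLabel_of_dvd {ω : Omega} {N : ℕ} (hω : ∀ n, N ≤ n → ω n = ω N) {q : ℤ}
    (hq : (2 : ℤ) ^ N ∣ q) : dyadicLabel ω (ω N) q = ω N := by
  unfold dyadicLabel
  split_ifs with h
  · rfl
  · exact hω _ (((padicValInt_dvd_iff (p := 2) N q).1 hq).resolve_left h)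

theorem two_pow_dvd_half {K : ℕ} {n : ℤ} (hn : n % 2 = 0) :
    (2 : ℤ) ^ K ∣ n / 2 ↔ (2 : ℤ) ^ (K + 1) ∣ n := by
  obtain ⟨m, rfl⟩ : ∃ m, n = 2 * m := ⟨n / 2, by omega⟩
  rw [pow_succ', mul_dvd_mul_iff_left two_ne_zero, Int.mul_ediv_cancel_left _ two_ne_zero]

/-- The reflection `n ↦ -1 - n` of vertices carries the block between `n` and `n + 1` to the block
indexed `-2 - n`, and `v₂` ignores signs. This is what lets reversed occurrences of a window count
as occurrences. -/
theorem toeplitz_symm (ω : Omega) (i : Fin 3) (n : ℤ) :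
    toeplitz ω i (-2 - n) = toeplitz ω i n := by
  unfold toeplitz
  by_cases h : n % 2 = 0
  · rw [if_pos h, if_pos (by omega)]
  · rw [if_neg h, if_neg (by omega), ← dyadicLabel_neg]
    congr 2
    omega

/-- The Toeplitz property: adding a multiple of `2 ^ (K + 1)` does not change a valuation smaller
than `K + 1`. Neither position is the hole, so the two fillings may differ. -/
theorem toeplitz_add (ω : Omega) (i j : Fin 3) {n r : ℤ} {K : ℕ}
    (hn : ¬ (2 : ℤ) ^ (K + 1) ∣ n + 1) (hr : (2 : ℤ) ^ (K + 1) ∣ r) :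
    toeplitz ω i (n + r) = toeplitz ω j n := by
  have h2 : r % 2 = 0 := Int.emod_eq_zero_of_dvd ((dvd_pow_self 2 K.succ_ne_zero).trans hr)
  unfold toeplitz
  by_cases h : n % 2 = 0
  · rw [if_pos h, if_pos (by omega)]
  · rw [if_neg h, if_neg (by omega), ← dyadicLabel_add ω i j (q := (n + 1) / 2) (r := r / 2)
      (mt (two_pow_dvd_half (by omega)).1 hn) ((two_pow_dvd_half h2).2 hr)]
    congr 2
    omega

theorem toeplitz_fill (ω : Omega) (i j : Fin 3) {n : ℤ} (hn : n ≠ -1) :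
    toeplitz ω i n = toeplitz ω j n := by
  unfold toeplitz dyadicLabel
  by_cases h : n % 2 = 0
  · simp [h]
  · rw [if_neg h, if_neg h, if_neg (by omega), if_neg (by omega)]

theorem toeplitz_neg_one (ω : Omega) (i : Fin 3) : toeplitz ω i (-1) = .lam i := by
  simp [toeplitz, dyadicLabel]

theorem not_dvd_of_pos_of_lt {m k : ℤ} (h0 : 0 < m) (h1 : m < k) : ¬ k ∣ m :=
  fun h => by have := Int.le_of_dvd h0 h; omega

/-- The translation moves the hole to `2 ^ (K + 1) - 1`, where the index is `ω K = i`. So even a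
window around the hole reappears far to the right, provided that `i` is a value of `ω` at a late
place. -/
theorem toeplitz_add_two_pow {ω : Omega} {i : Fin 3} {K : ℕ} (hK : ω K = i) {n : ℤ}
    (h0 : -2 ^ (K + 1) < n + 1) (h1 : n + 1 < 2 ^ (K + 1)) :
    toeplitz ω i (n + 2 ^ (K + 1)) = toeplitz ω i n := by
  rcases lt_trichotomy (n + 1) 0 with h | h | h
  · refine toeplitz_add ω i i (fun hd => ?_) dvd_rfl
    exact not_dvd_of_pos_of_lt (m := -(n + 1)) (by omega) (by omega) ((dvd_neg).2 hd)
  · obtain rfl : n = -1 := by omega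
    have h2 : (-1 + 2 ^ (K + 1) + 1 : ℤ) / 2 = 2 ^ K := by
      rw [pow_succ]
      omega
    rw [toeplitz_neg_one, toeplitz, h2, dyadicLabel_two_pow, hK, if_neg]
    rw [pow_succ]
    omega
  · exact toeplitz_add ω i i (not_dvd_of_pos_of_lt h h1) dvd_rfl

theorem toeplitz_periodic {ω : Omega} {N : ℕ} (hω : ∀ n, N ≤ n → ω n = ω N) (n : ℤ) :
    toeplitz ω (ω N) (n + 2 ^ (N + 1)) = toeplitz ω (ω N) n := by
  by_cases h : (2 : ℤ) ^ (N + 1) ∣ n + 1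
  · have h2 : (n + 1) % 2 = 0 :=
      Int.emod_eq_zero_of_dvd ((dvd_pow_self 2 N.succ_ne_zero).trans h)
    have h3 : ((2 : ℤ) ^ (N + 1)) % 2 = 0 :=
      Int.emod_eq_zero_of_dvd (dvd_pow_self 2 N.succ_ne_zero)
    unfold toeplitz
    rw [if_neg (by omega), if_neg (by omega),
      dyadicLabel_of_dvd hω ((two_pow_dvd_half h2).2 h),
      dyadicLabel_of_dvd hω ((two_pow_dvd_half (by omega)).2 _)]
    rw [add_right_comm]
    exact dvd_add h dvd_rfl
  · exact toeplitz_add _ _ _ h dvd_rfl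

/-! ### The action on the vertices of an alternating line -/

/-- Every second block is `theta`. -/
def Alternating (x : ℤ → Block) : Prop := ∀ n, x n = .theta ↔ x (n + 1) ≠ .theta

theorem toeplitz_alternating (ω : Omega) (i : Fin 3) : Alternating (toeplitz ω i) := by
  intro n
  unfold toeplitz
  by_cases h : n % 2 = 0
  · simp [h, show (n + 1) % 2 ≠ 0 by omega]
  · simp [h, show (n + 1) % 2 = 0 by omega]

/-- `Θ` joins by `a` only and no `Λ` joins by `a`. Hence a vertex never has edges with the same
label on both sides, and moving along a label is an involution. -/
theorem Alternating.not_joins {x : ℤ → Block} (hx : Alternating x) {n : ℤ} {s : Gen}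
    (h : (x n).Joins s) : ¬ (x (n + 1)).Joins s := by
  have h3 := hx n
  intro h2
  cases h4 : x n <;> cases h5 : x (n + 1) <;> simp_all [Block.Joins]

/-- The position of a neighbour relative to a vertex lying between the blocks `l` and `r`. -/
noncomputable def step (l r : Block) (s : Gen) : ℤ :=
  open Classical in if r.Joins s then 1 else if l.Joins s then -1 else 0

/-- The other end of the edge labelled `s` at the vertex `n` of an alternating line. -/
noncomputable def move (x : ℤ → Block) (s : Gen) (n : ℤ) : ℤ := n + step (x (n - 1)) (x n) s

theorem move_of_joins_right {x : ℤ → Block} {s : Gen} {n : ℤ} (h : (x n).Joins s) :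
    move x s n = n + 1 := by
  simp [move, step, h]

theorem move_of_joins_left {x : ℤ → Block} (hx : Alternating x) {s : Gen} {n : ℤ}
    (h : (x (n - 1)).Joins s) : move x s n = n - 1 := by
  have h2 := hx.not_joins h
  rw [sub_add_cancel] at h2
  rw [move, step, if_neg h2, if_pos h, sub_eq_add_neg]

theorem move_of_not_joins {x : ℤ → Block} {s : Gen} {n : ℤ} (h : ¬ (x (n - 1)).Joins s)
    (h2 : ¬ (x n).Joins s) : move x s n = n := by
  simp [move, step, h, h2]

theorem move_involutive {x : ℤ → Block} (hx : Alternating x) (s : Gen) :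
    Function.Involutive (move x s) := by
  intro n
  by_cases h : (x n).Joins s
  · rw [move_of_joins_right h, move_of_joins_left hx (by simpa using h)]
    ring
  by_cases h2 : (x (n - 1)).Joins s
  · rw [move_of_joins_left hx h2, move_of_joins_right h2]
    ring
  · rw [move_of_not_joins h2 h, move_of_not_joins h2 h]

/-- The action of words in the generators on the vertices of an alternating line. -/
noncomputable def vertexAct {x : ℤ → Block} (hx : Alternating x) :
    FreeGroup Gen →* Equiv.Perm ℤ :=
  FreeGroup.lift fun s => (move_involutive hx s).toPerm

theorem vertexAct_of {x : ℤ → Block} (hx : Alternating x) (s : Gen) (n : ℤ) :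
    vertexAct hx (FreeGroup.of s) n = move x s n := by
  simp [vertexAct]

theorem vertexAct_of_inv {x : ℤ → Block} (hx : Alternating x) (s : Gen) (n : ℤ) :
    vertexAct hx (FreeGroup.of s)⁻¹ n = move x s n := by
  rw [map_inv, Equiv.Perm.inv_eq_iff_eq, vertexAct_of, move_involutive hx]

theorem step_abs_le (l r : Block) (s : Gen) : |step l r s| ≤ 1 := by
  unfold step
  split_ifs <;> simp

/-- The displacement of a vertex under a word is bounded, and only depends on a bounded
neighbourhood of the vertex. -/
theorem vertexAct_local (w : FreeGroup Gen) : ∃ L : ℕ,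
    (∀ (x : ℤ → Block) (hx : Alternating x) (n : ℤ), |vertexAct hx w n - n| ≤ L) ∧
    ∀ (x z : ℤ → Block) (hx : Alternating x) (hz : Alternating z) (n m : ℤ),
      (∀ j : ℤ, |j| ≤ L → x (n + j) = z (m + j)) →
      vertexAct hx w n - n = vertexAct hz w m - m := by
  have hgen : ∀ s, (∀ (x : ℤ → Block) (n : ℤ), |move x s n - n| ≤ 1) ∧
      ∀ (x z : ℤ → Block) (n m : ℤ),
      (∀ j : ℤ, |j| ≤ 1 → x (n + j) = z (m + j)) → move x s n - n = move z s m - m := by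
    intro s
    refine ⟨fun x n => by simpa [move] using step_abs_le _ _ _, fun x z n m h => ?_⟩
    have h0 := h 0 (by simp)
    have h1 := h (-1) (by simp)
    simp only [add_zero, ← sub_eq_add_neg] at h0 h1
    simp [move, h0, h1]
  induction w using FreeGroup.induction_on with
  | C1 => exact ⟨0, by simp, by simp⟩
  | of s =>
    refine ⟨1, fun x hx n => ?_, fun x z hx hz n m h => ?_⟩
    · simpa [vertexAct_of] using (hgen s).1 x n
    · simpa [vertexAct_of] using (hgen s).2 x z n m (by simpa using h)
  | inv_of s _ =>
    refine ⟨1, fun x hx n => ?_, fun x z hx hz n m h => ?_⟩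
    · rw [vertexAct_of_inv]
      simpa using (hgen s).1 x n
    · rw [vertexAct_of_inv, vertexAct_of_inv]
      exact (hgen s).2 x z n m (by simpa using h)
  | mul v w hv hw =>
    obtain ⟨L, hL, hL2⟩ := hv
    obtain ⟨M, hM, hM2⟩ := hw
    refine ⟨L + M, fun x hx n => ?_, fun x z hx hz n m h => ?_⟩
    · have h1 := hL x hx (vertexAct hx w n)
      have h2 := hM x hx n
      rw [map_mul, Equiv.Perm.mul_apply]
      push_cast
      rw [abs_le] at *
      constructor <;> linarith [h1.1, h1.2, h2.1, h2.2]
    · have h2 := hM2 x z hx hz n m fun j hj => h j (hj.trans (by push_cast; omega))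
      have h3 := hM x hx n
      -- `v` acts at the vertex already displaced by `w`; its window of radius `L` lies within
      -- radius `L + M` of the original vertex.
      have h1 := hL2 x z hx hz (vertexAct hx w n) (vertexAct hz w m) fun j hj => by
        have := h (j + (vertexAct hx w n - n)) ((abs_add_le _ _).trans (by push_cast; omega))
        rwa [show n + (j + (vertexAct hx w n - n)) = vertexAct hx w n + j by ring, h2,
          show m + (j + (vertexAct hz w m - m)) = vertexAct hz w m + j by ring] at this
      rw [map_mul, map_mul, Equiv.Perm.mul_apply, Equiv.Perm.mul_apply]
      omega

/-! ### The Gray code and the action on strings -/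

/-- The complemented Gray code of an integer (in two's complement). -/
def gray (n : ℤ) (i : ℕ) : Bool := decide ((n / 2 ^ i) % 2 = (n / 2 ^ (i + 1)) % 2)

theorem gray_zero (n : ℤ) : gray n 0 = decide (n % 2 = (n / 2) % 2) := by
  simp [gray]

theorem gray_succ (n : ℤ) (i : ℕ) : gray n (i + 1) = gray (n / 2) i := by
  unfold gray
  rw [Int.ediv_ediv_of_nonneg zero_le_two, Int.ediv_ediv_of_nonneg zero_le_two, ← pow_succ',
    ← pow_succ']

/-- In two's complement, `-1 - n` has all bits of `n` flipped, and the Gray code only compares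
neighbouring bits. -/
theorem gray_symm (n : ℤ) : gray (-1 - n) = gray n := by
  funext i
  induction i generalizing n with
  | zero =>
    rw [gray_zero, gray_zero, decide_eq_decide, show (-1 - n) / 2 = -1 - n / 2 by omega]
    omega
  | succ i ih => rw [gray_succ, gray_succ, show (-1 - n) / 2 = -1 - n / 2 by omega, ih]

theorem gray_apply_zero : gray 0 = rho := by
  funext i
  simp [gray, rho]

theorem gray_injOn {n m : ℕ} (h : gray n = gray m) : n = m := by
  induction hk : n + m using Nat.strong_induction_on generalizing n m with
  | _ k ih =>
    rcases Nat.eq_zero_or_pos k with h0 | h0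
    · omega
    have h1 : n / 2 = m / 2 := by
      refine ih (n / 2 + m / 2) (by omega) (funext fun i => ?_) rfl
      have := congrFun h (i + 1)
      rw [gray_succ, gray_succ] at this
      exact_mod_cast this
    have h2 := congrFun h 0
    rw [gray_zero, gray_zero, decide_eq_decide] at h2
    omega

theorem gray_eq_iff {n m : ℤ} : gray n = gray m ↔ n = m ∨ n = -1 - m := by
  constructor
  · intro h
    have key : ∀ n : ℤ, ∃ k : ℕ, (n = k ∨ n = -1 - k) ∧ gray n = gray k := by
      intro n
      rcases le_or_gt 0 n with h | h
      · exact ⟨n.toNat, by omega, by rw [Int.toNat_of_nonneg h]⟩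
      · refine ⟨(-1 - n).toNat, by omega, ?_⟩
        rw [Int.toNat_of_nonneg (by omega), gray_symm]
    obtain ⟨k, hk, hk2⟩ := key n
    obtain ⟨l, hl, hl2⟩ := key m
    have := gray_injOn (hk2.symm.trans (h.trans hl2))
    omega
  · rintro (rfl | rfl)
    · rfl
    · exact gray_symm m

/-- The prefix of length `L` of an infinite string. -/
def strPrefix (L : ℕ) (γ : ℕ → Bool) : List Bool := List.ofFn fun i : Fin L => γ i

theorem strPrefix_zero (γ : ℕ → Bool) : strPrefix 0 γ = [] := by simp [strPrefix]

theorem strPrefix_gray_succ (L : ℕ) (n : ℤ) :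
    strPrefix (L + 1) (gray n) = gray n 0 :: strPrefix L (gray (n / 2)) := by
  simp [strPrefix, List.ofFn_succ, gray_succ]

theorem getD_strPrefix (n : ℕ) (γ : ℕ → Bool) : (strPrefix (n + 1) γ).getD n false = γ n := by
  rw [strPrefix, List.getD_eq_getElem _ _ (by simp), List.getElem_ofFn]

/-- The high bits are an arbitrary large integer; each letter, read from the last to the first,
selects one of the extensions `2 * n` and `2 * n + 1`. This makes the far right of the line see all
finite strings. -/
theorem exists_strPrefix_gray (v : List Bool) (B : ℕ) :
    ∃ n : ℤ, (B : ℤ) ≤ n ∧ strPrefix v.length (gray n) = v := by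
  induction v with
  | nil => exact ⟨B, le_rfl, strPrefix_zero _⟩
  | cons b v ih =>
    obtain ⟨n, hn, hv⟩ := ih
    obtain ⟨m, hm, hmn, hb⟩ : ∃ m : ℤ, n ≤ m ∧ m / 2 = n ∧ decide (m % 2 = n % 2) = b := by
      rcases Int.emod_two_eq_zero_or_one n with h | h <;> cases b
      · exact ⟨2 * n + 1, by omega, by omega, by simp [h]⟩
      · exact ⟨2 * n, by omega, by omega, by simp [h]⟩
      · exact ⟨2 * n, by omega, by omega, by simp [h]⟩
      · exact ⟨2 * n + 1, by omega, by omega, by simp [h]⟩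
    refine ⟨m, hn.trans hm, ?_⟩
    rw [List.length_cons, strPrefix_gray_succ, gray_zero, hmn, hb, hv]

/-- Here `n` and `m` differ in the lowest bit only, which enters only the first letter of the code.
-/
theorem aFun_strPrefix (L : ℕ) {n m : ℤ} (h : n / 2 = m / 2) (hne : n ≠ m) :
    aFun (strPrefix L (gray n)) = strPrefix L (gray m) := by
  cases L with
  | zero => simp [strPrefix_zero, aFun]
  | succ L =>
    rw [strPrefix_gray_succ, strPrefix_gray_succ, aFun, h, gray_zero, gray_zero, h,
      ← decide_not]
    congr 1
    rw [decide_eq_decide]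
    omega

/-- The integer `q` numbers the block joining the vertices `2 * q - 1` and `2 * q`, and `4 * q - 1 -
n` is the end other than `n`. For `q` even the first letter is 1 and halving leads to the block `q /
2` of the shifted parameter; for `q` odd the first letter is 0, and crossing the block flips the
second letter. At `q = 0` crossing and staying are both allowed, since `-1` and `0` have the same
code. -/
theorem tFun_strPrefix (k : Fin 3) (ω : Omega) (i : Fin 3) (L : ℕ) (q n m : ℤ)
    (hn : n = 2 * q ∨ n = 2 * q - 1)
    (h : (m = 4 * q - 1 - n ∧ (q = 0 ∨ dyadicLabel ω i q ≠ k)) ∨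
      (m = n ∧ (q = 0 ∨ dyadicLabel ω i q = k))) :
    tFun k ω (strPrefix L (gray n)) = strPrefix L (gray m) := by
  induction L generalizing ω q n m with
  | zero => simp [strPrefix_zero, tFun]
  | succ L ih =>
    have h0 : gray n 0 = decide (q % 2 = 0) ∧ gray m 0 = decide (q % 2 = 0) := by
      rw [gray_zero, gray_zero, decide_eq_decide, decide_eq_decide]
      omega
    rw [strPrefix_gray_succ, strPrefix_gray_succ, h0.1, h0.2]
    rcases Int.emod_two_eq_zero_or_one q with hq | hq
    · obtain ⟨r, rfl⟩ : ∃ r, q = 2 * r := ⟨q / 2, by omega⟩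
      rw [dyadicLabel_two_mul] at h
      simp only [hq, decide_true, tFun]
      rw [ih ω.shift r (n / 2) (m / 2) (by omega) (by
        rcases h with ⟨h1, h2⟩ | ⟨h1, h2⟩
        · exact Or.inl ⟨by omega, h2.imp_left (by omega)⟩
        · exact Or.inr ⟨by omega, h2.imp_left (by omega)⟩)]
    · rw [dyadicLabel_of_odd _ _ hq] at h
      have h3 : m / 2 / 2 = n / 2 / 2 := by omega
      simp only [hq, one_ne_zero, decide_false]
      cases L with
      | zero => simp [strPrefix_zero, tFun]
      | succ L =>
        rw [strPrefix_gray_succ, strPrefix_gray_succ, tFun, h3, gray_zero, gray_zero, h3]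
        rcases h with ⟨h1, h2⟩ | ⟨h1, h2⟩
        · rw [if_neg (fun hk => h2.elim (by omega) fun h2 => h2 hk.symm), ← decide_not]
          congr 2
          rw [decide_eq_decide]
          omega
        · rw [if_pos (h2.resolve_left (by omega)).symm, h1]

/-- The index of the rule defining a generator other than `a`. -/
def Gen.index : Gen → Fin 3
  | .a => 0
  | .b => 2
  | .c => 1
  | .d => 0

theorem genAut_of_ne_a (ω : Omega) {s : Gen} (hs : s ≠ .a) (v : List Bool) :
    genAut ω s v = tFun s.index ω v := by
  cases s
  · exact (hs rfl).elim
  all_goals rfl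

theorem Block.lam_joins_iff {i : Fin 3} {s : Gen} (hs : s ≠ .a) :
    (Block.lam i).Joins s ↔ i ≠ s.index := by
  fin_cases i <;> cases s <;> simp [Block.Joins, loopLabel, Gen.index] at hs ⊢

theorem genAut_strPrefix (ω : Omega) (i : Fin 3) (s : Gen) (L : ℕ) (n : ℤ) :
    genAut ω s (strPrefix L (gray n)) = strPrefix L (gray (move (toeplitz ω i) s n)) := by
  have hx := toeplitz_alternating ω i
  by_cases hs : s = .a
  · subst hs
    change aFun _ = _
    by_cases h : n % 2 = 0
    · rw [move_of_joins_right (by simp [toeplitz, h, Block.Joins])]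
      exact aFun_strPrefix L (by omega) (by omega)
    · rw [move_of_joins_left hx (by simp [toeplitz, show (n - 1) % 2 = 0 by omega, Block.Joins])]
      exact aFun_strPrefix L (by omega) (by omega)
  · rw [genAut_of_ne_a ω hs]
    -- The unique `Λ` block at the vertex `n` is block `n` for `n` odd and block `n - 1` for `n`
    -- even; its number is `(n + 1) / 2` in both cases.
    refine tFun_strPrefix _ ω i L ((n + 1) / 2) n _ (by omega) ?_
    by_cases h : n % 2 = 0
    · have h1 : ¬ (toeplitz ω i n).Joins s := by simp [toeplitz, h, Block.Joins, hs]
      have h2 : (toeplitz ω i (n - 1)).Joins s ↔ dyadicLabel ω i ((n + 1) / 2) ≠ s.index := by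
        rw [toeplitz, if_neg (by omega), Block.lam_joins_iff hs]
        rw [show (n - 1 + 1) / 2 = (n + 1) / 2 by omega]
      by_cases h3 : (toeplitz ω i (n - 1)).Joins s
      · rw [move_of_joins_left hx h3]
        exact Or.inl ⟨by omega, Or.inr (h2.1 h3)⟩
      · rw [move_of_not_joins h3 h1]
        exact Or.inr ⟨rfl, Or.inr (not_not.1 (mt h2.2 h3))⟩
    · have h1 : ¬ (toeplitz ω i (n - 1)).Joins s := by
        simp [toeplitz, show (n - 1) % 2 = 0 by omega, Block.Joins, hs]
      have h2 : (toeplitz ω i n).Joins s ↔ dyadicLabel ω i ((n + 1) / 2) ≠ s.index := by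
        rw [toeplitz, if_neg h, Block.lam_joins_iff hs]
      by_cases h3 : (toeplitz ω i n).Joins s
      · rw [move_of_joins_right h3]
        exact Or.inl ⟨by omega, Or.inr (h2.1 h3)⟩
      · rw [move_of_not_joins h1 h3]
        exact Or.inr ⟨rfl, Or.inr (not_not.1 (mt h2.2 h3))⟩

/-! ### Words acting on the tree and on the line -/

/-- The evaluation of words in the group of tree automorphisms. -/
def treeAct (ω : Omega) : FreeGroup Gen →* TreeAut := FreeGroup.lift (genAut ω)

theorem genAut_involutive (ω : Omega) (s : Gen) : Function.Involutive (genAut ω s) := by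
  cases s
  · exact aFun_involutive
  all_goals exact tFun_involutive _ ω

theorem treeAct_strPrefix (ω : Omega) (i : Fin 3) (w : FreeGroup Gen) (L : ℕ) (n : ℤ) :
    treeAct ω w (strPrefix L (gray n)) =
      strPrefix L (gray (vertexAct (toeplitz_alternating ω i) w n)) := by
  induction w using FreeGroup.induction_on generalizing n with
  | C1 => simp
  | of s =>
    rw [vertexAct_of, ← genAut_strPrefix]
    simp [treeAct]
  | inv_of s _ =>
    rw [vertexAct_of_inv, ← genAut_strPrefix, map_inv]
    change (treeAct ω (FreeGroup.of s)).symm _ = _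
    rw [RelIso.symm_apply_eq, treeAct, FreeGroup.lift_apply_of, genAut_involutive]
  | mul v w hv hw =>
    rw [map_mul, map_mul, Equiv.Perm.mul_apply, ← hv, ← hw]
    rfl

theorem eq_of_forall_strPrefix_eq {γ η : ℕ → Bool} (h : ∀ L, strPrefix L γ = strPrefix L η) :
    γ = η := by
  funext n
  rw [← getD_strPrefix n γ, h, getD_strPrefix]

/-- A word is trivial in the Grigorchuk group if and only if it fixes all vertices of the Toeplitz
line that are sufficiently far to the right. -/
theorem treeAct_eq_one_iff (ω : Omega) (i : Fin 3) (w : FreeGroup Gen) :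
    treeAct ω w = 1 ↔
      ∃ B : ℕ, ∀ n : ℤ, B ≤ n → vertexAct (toeplitz_alternating ω i) w n = n := by
  constructor
  · intro h
    obtain ⟨L, hL, -⟩ := vertexAct_local w
    refine ⟨L, fun n hn => ?_⟩
    have h1 : gray (vertexAct (toeplitz_alternating ω i) w n) = gray n :=
      eq_of_forall_strPrefix_eq fun M => by
        rw [← treeAct_strPrefix, h]
        rfl
    -- Bounded displacement excludes the mirror image `-1 - n`, which is at distance `2 * n + 1 >
    -- L`.
    have h2 := hL _ (toeplitz_alternating ω i) n
    rw [abs_le] at h2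
    rw [gray_eq_iff] at h1
    omega
  · rintro ⟨B, hB⟩
    ext1 v
    obtain ⟨n, hn, hv⟩ := exists_strPrefix_gray v B
    rw [← hv, treeAct_strPrefix ω i, hB n hn]
    rfl

theorem range_treeAct (ω : Omega) : (treeAct ω).range = grigorchukGroup ω := by
  rw [treeAct, FreeGroup.range_lift_eq_closure, grigorchukGroup]

/-- The evaluation of words in the Grigorchuk group. -/
def wordEval (ω : Omega) : FreeGroup Gen →* grigorchukGroup ω := FreeGroup.lift (gen ω)

theorem coe_wordEval (ω : Omega) (w : FreeGroup Gen) : (wordEval ω w : TreeAut) = treeAct ω w := by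
  have : (grigorchukGroup ω).subtype.comp (wordEval ω) = treeAct ω := by
    ext1 s
    simp [wordEval, treeAct, gen]
  exact DFunLike.congr_fun this w

theorem wordEval_surjective (ω : Omega) : Function.Surjective (wordEval ω) := by
  rintro ⟨g, hg⟩
  rw [← range_treeAct] at hg
  obtain ⟨w, rfl⟩ := hg
  exact ⟨w, Subtype.ext (coe_wordEval ω w)⟩

/-- A homomorphism on words whose kernel consists of the words trivial in the Grigorchuk group
defines an embedding of the Grigorchuk group. -/
theorem exists_injective_hom_of_ker {H : Type*} [Group H] (ω : Omega) (θ : FreeGroup Gen →* H)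
    (h : ∀ w, treeAct ω w = 1 ↔ θ w = 1) :
    ∃ ι : grigorchukGroup ω →* H, Function.Injective ι ∧ ∀ w, ι (wordEval ω w) = θ w := by
  have hk : ∀ w, wordEval ω w = 1 ↔ θ w = 1 := by
    intro w
    rw [← h, ← coe_wordEval, OneMemClass.coe_eq_one]
  have hs := wordEval_surjective ω
  let ι := (wordEval ω).liftOfSurjective hs ⟨θ, fun w hw => (hk w).1 hw⟩
  have hι : ∀ w, ι (wordEval ω w) = θ w := fun w =>
    MonoidHom.liftOfRightInverse_comp_apply _ _ _ _ w
  refine ⟨ι, ?_, hι⟩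
  rw [injective_iff_map_eq_one]
  intro g hg
  obtain ⟨w, rfl⟩ := hs g
  rw [hι] at hg
  exact (hk w).2 hg

/-! ### Adjacency in lines and in the Schreier graph -/

theorem Block.exists_joins (β : Block) : ∃ s, β.Joins s := by
  rcases β with _ | i
  · exact ⟨.a, rfl⟩
  · fin_cases i
    · exact ⟨.b, by simp [Block.Joins, loopLabel]⟩
    · exact ⟨.b, by simp [Block.Joins, loopLabel]⟩
    · exact ⟨.c, by simp [Block.Joins, loopLabel]⟩

theorem loopLabel_ne_a (i : Fin 3) : loopLabel i ≠ .a := by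
  fin_cases i <;> simp [loopLabel]

theorem loopLabel_injective : Function.Injective loopLabel := by
  intro i j h
  fin_cases i <;> fin_cases j <;> simp_all [loopLabel]

/-- The sets of joining labels, `{a}` and the three pairs from `{b, c, d}`, form an antichain. One
inclusion is all that an embedding of graphs provides. -/
theorem Block.eq_of_joins_imp {β β' : Block} (h : ∀ s, β.Joins s → β'.Joins s) : β = β' := by
  rcases β with _ | i <;> rcases β' with _ | j
  · rfl
  · exact ((h .a rfl).1 rfl).elim
  · obtain ⟨s, hs⟩ := (Block.lam i).exists_joins
    exact (hs.1 (h s hs)).elim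
  · by_contra hne
    exact (h (loopLabel j) ⟨loopLabel_ne_a j, fun hl => hne
      (congrArg Block.lam (loopLabel_injective hl.symm))⟩).2 rfl

theorem Alternating.loops_iff {x : ℤ → Block} (hx : Alternating x) (n : ℤ) (s : Gen) :
    (x (n - 1)).Loops s ∨ (x n).Loops s ↔ ¬ (x (n - 1)).Joins s ∧ ¬ (x n).Joins s := by
  have h := hx (n - 1)
  rw [sub_add_cancel] at h
  rcases h1 : x (n - 1) with _ | i <;> rcases h2 : x n with _ | j <;>
    rw [h1, h2] at h <;> simp [Block.Joins, Block.Loops] at h ⊢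
  · have := loopLabel_ne_a j
    grind
  · have := loopLabel_ne_a i
    grind

theorem blockGraph_adj_iff {x : ℤ → Block} (hx : Alternating x) {s : Gen} {i j : ℤ} :
    (blockGraph x).Adj s i j ↔ move x s i = j := by
  constructor
  · rintro ⟨n, -, ⟨h, ⟨rfl, rfl⟩ | ⟨rfl, rfl⟩⟩ | ⟨h, rfl, rfl | rfl⟩⟩
    · exact move_of_joins_right h
    · rw [move_of_joins_left hx (by rwa [add_sub_cancel_right]), add_sub_cancel_right]
    · have := (hx.loops_iff i s).1 (Or.inr h)
      exact move_of_not_joins this.1 this.2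
    · have := (hx.loops_iff (n + 1) s).1 (Or.inl (by rwa [add_sub_cancel_right]))
      exact move_of_not_joins this.1 this.2
  · rintro rfl
    by_cases h : (x i).Joins s
    · rw [move_of_joins_right h]
      exact ⟨i, trivial, Or.inl ⟨h, Or.inl ⟨rfl, rfl⟩⟩⟩
    by_cases h2 : (x (i - 1)).Joins s
    · rw [move_of_joins_left hx h2]
      exact ⟨i - 1, trivial, Or.inl ⟨h2, Or.inr ⟨by ring, rfl⟩⟩⟩
    rw [move_of_not_joins h2 h]
    rcases (hx.loops_iff i s).2 ⟨h2, h⟩ with h3 | h3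
    · exact ⟨i - 1, trivial, Or.inr ⟨h3, rfl, Or.inr (by ring)⟩⟩
    · exact ⟨i, trivial, Or.inr ⟨h3, rfl, Or.inl rfl⟩⟩

/-- Among edges with both ends in the half-line, only the loops at `0` of the block `-1` are lost by
the cut, and a `Θ` at `0` contributes no loop there. These are the loops erased at `ρ`. -/
theorem halfLine_adj_iff {x : ℤ → Block} (hx : x 0 = .theta) {s : Gen} {i j : ℤ} (hi : 0 ≤ i)
    (hj : 0 ≤ j) :
    (blockGraphOn (Set.Ici 0) x).Adj s i j ↔ (blockGraph x).Adj s i j ∧ ¬ (i = 0 ∧ j = 0) := by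
  constructor
  · rintro ⟨n, hn, h⟩
    refine ⟨⟨n, trivial, h⟩, ?_⟩
    rintro ⟨rfl, rfl⟩
    have hn : 0 ≤ n := hn
    rcases h with ⟨-, h⟩ | ⟨h, -, h2⟩
    · omega
    · obtain rfl : n = 0 := by omega
      rwa [hx] at h
  · rintro ⟨⟨n, -, h⟩, h0⟩
    exact ⟨n, show 0 ≤ n by omega, h⟩

theorem boundaryAct_treeAct (ω : Omega) (i : Fin 3) (w : FreeGroup Gen) (n : ℤ) :
    boundaryAct (treeAct ω w) (gray n) =
      gray (vertexAct (toeplitz_alternating ω i) w n) := by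
  funext m
  rw [← getD_strPrefix m (gray (vertexAct (toeplitz_alternating ω i) w n)), ← treeAct_strPrefix]
  rfl

theorem boundaryAct_genAut (ω : Omega) (i : Fin 3) (s : Gen) (n : ℤ) :
    boundaryAct (genAut ω s) (gray n) = gray (move (toeplitz ω i) s n) := by
  rw [← vertexAct_of (toeplitz_alternating ω i), ← boundaryAct_treeAct]
  simp [treeAct]

theorem exists_vertexAct_zero_eq {x : ℤ → Block} (hx : Alternating x) (n : ℕ) :
    ∃ w, vertexAct hx w 0 = n := by
  induction n with
  | zero => exact ⟨1, by simp⟩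
  | succ n ih =>
    obtain ⟨w, hw⟩ := ih
    obtain ⟨s, hs⟩ := (x n).exists_joins
    refine ⟨FreeGroup.of s * w, ?_⟩
    rw [map_mul, Equiv.Perm.mul_apply, hw, vertexAct_of, move_of_joins_right hs]
    push_cast
    rfl

theorem mem_orbitRho_iff (ω : Omega) (γ : ℕ → Bool) :
    γ ∈ orbitRho ω ↔ ∃ n : ℕ, gray n = γ := by
  change (∃ g ∈ grigorchukGroup ω, boundaryAct g rho = γ) ↔ _
  rw [← range_treeAct, ← gray_apply_zero]
  constructor
  · rintro ⟨_, ⟨w, rfl⟩, rfl⟩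
    rw [boundaryAct_treeAct ω 0]
    set m := vertexAct (toeplitz_alternating ω 0) w 0
    rcases le_or_gt 0 m with h | h
    · exact ⟨m.toNat, by rw [Int.toNat_of_nonneg h]⟩
    · exact ⟨(-1 - m).toNat, by rw [Int.toNat_of_nonneg (by omega), gray_symm]⟩
  · rintro ⟨n, rfl⟩
    obtain ⟨w, hw⟩ := exists_vertexAct_zero_eq (toeplitz_alternating ω 0) n
    exact ⟨treeAct ω w, ⟨w, rfl⟩, by rw [boundaryAct_treeAct ω 0, hw]⟩

/-- The Gray code as an enumeration of the orbit of `ρ`. -/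
noncomputable def grayEquiv (ω : Omega) : ℕ ≃ orbitRho ω :=
  Equiv.ofBijective (fun n => ⟨gray n, (mem_orbitRho_iff ω _).2 ⟨n, rfl⟩⟩)
    ⟨fun _ _ h => gray_injOn (congrArg Subtype.val h), fun γ => by
      obtain ⟨n, hn⟩ := (mem_orbitRho_iff ω _).1 γ.2
      exact ⟨n, Subtype.ext hn⟩⟩

theorem toeplitz_zero (ω : Omega) (i : Fin 3) : toeplitz ω i 0 = .theta := rfl

theorem toeplitz_extendsSchreierGraph (ω : Omega) (i : Fin 3) :
    ExtendsSchreierGraph ω (toeplitz ω i) := by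
  have hx := toeplitz_alternating ω i
  have h0 : ∀ n : ℕ, gray n = rho ↔ n = 0 := fun n => by
    rw [← gray_apply_zero]
    exact ⟨fun h => gray_injOn (m := 0) h, fun h => by rw [h]; rfl⟩
  have h1 : ∀ s (n m : ℕ), boundaryAct (genAut ω s) (gray n) = gray m →
      move (toeplitz ω i) s n = m ∨ n = 0 ∧ m = 0 := by
    intro s n m h
    rw [boundaryAct_genAut ω i, gray_eq_iff] at h
    -- A move from `n ≥ 0` ends at `-1` or further right, so the mirror case `-1 - m` forces `m = 0`
    -- and `n = 0`.
    have h2 : -1 ≤ move (toeplitz ω i) s n - n := (abs_le.1 (by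
      simpa [move] using step_abs_le _ _ _)).1
    omega
  refine ⟨grayEquiv ω, gray_apply_zero, fun s n m => ?_⟩
  rw [halfLine_adj_iff (toeplitz_zero ω i) (Int.natCast_nonneg n) (Int.natCast_nonneg m),
    blockGraph_adj_iff hx]
  change _ ↔ (boundaryAct (genAut ω s) (gray n) = gray m ∨
    boundaryAct (genAut ω s) (gray m) = gray n) ∧ ¬ (gray n = rho ∧ gray m = rho)
  rw [h0, h0, Int.natCast_eq_zero, Int.natCast_eq_zero]
  refine and_congr_left fun hne => ⟨fun h => Or.inl ?_, fun h => ?_⟩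
  · rw [boundaryAct_genAut ω i, h]
  · rcases h with h | h
    · exact (h1 s n m h).resolve_right hne
    · have h2 := (h1 s m n h).resolve_right fun h => hne h.symm
      rw [← h2, move_involutive hx s]

/-- The blocks of a half-line are determined by the isomorphism class of the pointed half-line. -/
theorem ExtendsSchreierGraph.eq_of_nonneg {ω : Omega} {y z : ℤ → Block}
    (hy : ExtendsSchreierGraph ω y) (hz : ExtendsSchreierGraph ω z) {n : ℤ} (hn : 0 ≤ n) :
    y n = z n := by
  obtain ⟨f, hf0, hf⟩ := hy
  obtain ⟨g, hg0, hg⟩ := hz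
  let e : ℕ ≃ ℕ := f.trans g.symm
  have he : ∀ s (i j : ℕ), (blockGraphOn (Set.Ici 0) y).Adj s i j ↔
      (blockGraphOn (Set.Ici 0) z).Adj s (e i) (e j) := fun s i j => by simp [hf, hg, e]
  have hadj : ∀ (x : ℤ → Block) (n : ℕ) s, (x n).Joins s ↔
      (blockGraphOn (Set.Ici 0) x).Adj s n (n + 1 : ℕ) := by
    intro x n s
    constructor
    · exact fun h => ⟨n, Int.natCast_nonneg n, Or.inl ⟨h, Or.inl ⟨rfl, by simp⟩⟩⟩
    · rintro ⟨m, -, ⟨h, ⟨h1, h2⟩ | ⟨h1, h2⟩⟩ | ⟨-, h, -⟩⟩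
      · rwa [h1]
      · push_cast at h2
        omega
      · push_cast at h
        omega
  -- The image of `n + 1` is adjacent to the fixed vertex `n`; as `n` and `n - 1` are already taken,
  -- it can only be `n + 1`.
  have hid : ∀ n, e n = n := by
    intro n
    induction n using Nat.strong_induction_on with
    | _ n ih =>
      rcases n with _ | n
      · rw [Equiv.trans_apply, Equiv.symm_apply_eq]
        exact Subtype.ext (hf0.trans hg0.symm)
      · obtain ⟨s, hs⟩ := (y n).exists_joins
        have h1 := (he s _ _).1 ((hadj y n s).1 hs)
        rw [ih n (by omega)] at h1
        have h2 : e (n + 1) ≠ n := fun h => by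
          have := e.injective (h.trans (ih n (by omega)).symm)
          omega
        have h3 : n = 0 ∨ e (n + 1) ≠ n - 1 := by
          by_contra! h3
          have := e.injective (h3.2.trans (ih (n - 1) (by omega)).symm)
          omega
        obtain ⟨m, -, ⟨-, h⟩ | ⟨-, h, -⟩⟩ := h1 <;> omega
  lift n to ℕ using hn
  refine Block.eq_of_joins_imp fun s hs => (hadj z n s).2 ?_
  have := (he s n (n + 1)).1 ((hadj y n s).1 hs)
  rwa [hid, hid] at this

/-! ### Windows in sequences -/

theorem hasBasis_nhds_window {A : Type*} [TopologicalSpace A] [DiscreteTopology A] (z : ℤ → A) :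
    (𝓝 z).HasBasis (fun _ : ℕ => True) fun L => {x | ∀ j : ℤ, |j| ≤ L → x j = z j} := by
  constructor
  intro s
  constructor
  · intro hs
    rw [nhds_pi, Filter.mem_pi] at hs
    obtain ⟨I, hI, t, ht, hts⟩ := hs
    obtain ⟨L, hL⟩ := (hI.image Int.natAbs).bddAbove
    refine ⟨L, trivial, fun x hx => hts fun j hj => ?_⟩
    have h1 := hL (Set.mem_image_of_mem _ hj)
    rw [hx j (by rw [abs_le]; omega)]
    exact mem_of_mem_nhds (ht j)
  · rintro ⟨L, -, hL⟩
    refine Filter.mem_of_superset (set_pi_mem_nhds (Set.finite_Icc (-(L : ℤ)) L)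
      (s := fun j => {z j}) fun j _ => (isOpen_discrete _).mem_nhds rfl) fun x hx => hL ?_
    exact fun j hj => hx j (Set.mem_Icc.2 (abs_le.1 hj))

theorem shift_zpow_apply {A : Type*} [TopologicalSpace A] (k : ℤ) (x : ℤ → A) (n : ℤ) :
    (shift A ^ k) x n = x (n + k) := by
  induction k generalizing x n with
  | zero => simp
  | succ k ih =>
    rw [zpow_add_one]
    change (shift A ^ (k : ℤ)) (shift A x) n = _
    rw [ih]
    change x _ = _
    rw [add_assoc]
  | pred k ih =>
    rw [zpow_sub_one]
    change (shift A ^ (-k : ℤ)) ((shift A).symm x) n = _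
    rw [ih]
    change x _ = _
    congr 1
    ring

theorem Subshift.coe_map_zpow {A : Type*} [TopologicalSpace A] (Y : Subshift A) (k : ℤ)
    (x : Y.carrier) : ((Y.map ^ k) x : ℤ → A) = (shift A ^ k) x := by
  induction k generalizing x with
  | zero => simp
  | succ k ih =>
    rw [zpow_add_one, zpow_add_one]
    exact ih (Y.map x)
  | pred k ih =>
    rw [zpow_sub_one, zpow_sub_one]
    exact ih (Y.map.symm x)

/-! ### The subshift generated by the Toeplitz sequence -/

/-- The sequences all of whose windows occur in the Toeplitz sequence arbitrarily far to the
right. -/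
def toeplitzSet (ω : Omega) (i : Fin 3) : Set (ℤ → Block) :=
  {x | ∀ (L : ℕ) (B : ℤ), ∃ n ≥ B, ∀ j : ℤ, |j| ≤ L → x j = toeplitz ω i (n + j)}

theorem exists_lt_two_pow (m : ℤ) : ∃ K : ℕ, m < 2 ^ (K + 1) := by
  refine ⟨m.toNat, ?_⟩
  have h : m.toNat < 2 ^ (m.toNat + 1) :=
    Nat.lt_two_pow_self.trans_le (Nat.pow_le_pow_right two_pos (Nat.le_succ _))
  have h2 : (m.toNat : ℤ) < 2 ^ (m.toNat + 1) := by exact_mod_cast h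
  omega

theorem toeplitz_mem_toeplitzSet {ω : Omega} {i : Fin 3} (h : ∀ N, ∃ n ≥ N, ω n = i) :
    toeplitz ω i ∈ toeplitzSet ω i := by
  intro L B
  obtain ⟨K, hK⟩ := exists_lt_two_pow (|B| + L + 1)
  obtain ⟨M, hKM, hM⟩ := h K
  have h2 : (2 : ℤ) ^ (K + 1) ≤ 2 ^ (M + 1) := pow_le_pow_right₀ one_le_two (by omega)
  refine ⟨2 ^ (M + 1), by grind, fun j hj => ?_⟩
  rw [add_comm, toeplitz_add_two_pow hM] <;> grind

/-- For a large power of two, no position of a window that misses the hole lies in the exceptional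
residue class of `toeplitz_add`. -/
theorem exists_far_window (ω : Omega) (i : Fin 3) (L : ℕ) (n B : ℤ)
    (hn : ∀ j : ℤ, |j| ≤ L → n + j ≠ -1) :
    ∃ m ≥ B, ∀ j : ℤ, |j| ≤ L → toeplitz ω i (m + j) = toeplitz ω i (n + j) := by
  obtain ⟨K, hK⟩ := exists_lt_two_pow (|B| + |n| + L + 1)
  refine ⟨n + 2 ^ (K + 1), by grind, fun j hj => ?_⟩
  rw [add_right_comm, toeplitz_add ω i i (fun hd => ?_) dvd_rfl]
  have := Int.eq_zero_of_abs_lt_dvd hd (by grind)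
  exact hn j hj (by omega)

theorem toeplitzSet_shift {ω : Omega} {i : Fin 3} {x z : ℤ → Block} (hx : x ∈ toeplitzSet ω i)
    (k : ℤ) (hz : ∀ n, z n = x (n + k)) : z ∈ toeplitzSet ω i := by
  intro L B
  obtain ⟨n, hn, h⟩ := hx (L + k.natAbs) (B + |k|)
  refine ⟨n + k, by grind, fun j hj => ?_⟩
  rw [hz, h _ (by push_cast; grind)]
  congr 1
  ring

theorem isClosed_toeplitzSet (ω : Omega) (i : Fin 3) : IsClosed (toeplitzSet ω i) := by
  refine isClosed_of_closure_subset fun x hx L B => ?_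
  obtain ⟨z, hz, hzx⟩ := (mem_closure_iff_nhds_basis (hasBasis_nhds_window x)).1 hx L trivial
  obtain ⟨n, hn, h⟩ := hz L B
  exact ⟨n, hn, fun j hj => (hzx j hj).symm.trans (h j hj)⟩

theorem toeplitzSet_alternating {ω : Omega} {i : Fin 3} {x : ℤ → Block}
    (hx : x ∈ toeplitzSet ω i) : Alternating x := by
  intro n
  obtain ⟨m, -, h⟩ := hx (n.natAbs + 1) 0
  rw [h n (by push_cast; grind), h (n + 1) (by push_cast; grind), ← add_assoc]
  exact toeplitz_alternating ω i (m + n)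

/-- This is the source of minimality. The window of `z` occurs at positions between `0` and `2 ^ (K
+ 1) - 2`, hence at all translates by multiples of `2 ^ (K + 1)`. A stretch of `x` longer than this
period, copied from around `m`, must contain a translate, namely at the residue of `n - m`. -/
theorem toeplitzSet_recurrent {ω : Omega} {i : Fin 3} {x z : ℤ → Block}
    (hx : x ∈ toeplitzSet ω i) (hz : z ∈ toeplitzSet ω i) (L : ℕ) :
    ∃ k : ℤ, ∀ j : ℤ, |j| ≤ L → x (j + k) = z j := by
  obtain ⟨n, hn, h⟩ := hz L L
  obtain ⟨K, hK⟩ := exists_lt_two_pow (n + L + 1)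
  obtain ⟨m, -, h2⟩ := hx (2 ^ (K + 1) + L) 0
  have hpos : (0 : ℤ) < 2 ^ (K + 1) := by positivity
  have hk0 := Int.emod_nonneg (n - m) hpos.ne'
  have hk1 := Int.emod_lt_of_pos (n - m) hpos
  refine ⟨(n - m) % 2 ^ (K + 1), fun j hj => ?_⟩
  have hd : (2 : ℤ) ^ (K + 1) ∣ (n - m) % 2 ^ (K + 1) - (n - m) :=
    ((Int.mod_modEq (n - m) (2 ^ (K + 1))).symm).dvd
  rw [h2 _ (by push_cast; grind), h j hj,
    ← toeplitz_add ω i i (n := n + j) (not_dvd_of_pos_of_lt (by grind) (by grind)) hd]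
  congr 1
  ring

/-! ### Finite patterns -/

/-- A walk on `ℤ` with unit steps that turns back revisits the vertex it has just left. -/
theorem eq_add_or_eq_sub_of_injective {g : ℕ → ℤ} {N : ℕ}
    (hinj : ∀ s ≤ N, ∀ t ≤ N, g s = g t → s = t)
    (hstep : ∀ t < N, g (t + 1) = g t + 1 ∨ g (t + 1) = g t - 1) :
    (∀ t ≤ N, g t = g 0 + t) ∨ ∀ t ≤ N, g t = g 0 - t := by
  induction N with
  | zero => left; intro t ht; obtain rfl : t = 0 := by omega
            simp
  | succ N ih =>
    have hlast := hstep N (by omega)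
    rcases N with _ | N
    · refine hlast.imp (fun h t ht => ?_) (fun h t ht => ?_) <;>
      · obtain rfl | rfl : t = 0 ∨ t = 1 := by omega
        · simp
        · simpa using h
    have hne : g (N + 2) ≠ g N := fun h => by
      have := hinj _ le_rfl _ (by omega) h
      omega
    rcases ih (fun s hs t ht => hinj s (by omega) t (by omega))
      (fun t ht => hstep t (by omega)) with h | h
    · left
      intro t ht
      rcases Nat.lt_or_ge t (N + 2) with h1 | h1
      · exact h t (by omega)
      · obtain rfl : t = N + 2 := by omega
        have h2 := h N (by omega)
        have h3 := h (N + 1) le_rfl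
        push_cast at *
        rcases hlast with h4 | h4
        · rw [h4, h3]; ring
        · exact (hne (by rw [h4, h3, h2]; ring)).elim
    · right
      intro t ht
      rcases Nat.lt_or_ge t (N + 2) with h1 | h1
      · exact h t (by omega)
      · obtain rfl : t = N + 2 := by omega
        have h2 := h N (by omega)
        have h3 := h (N + 1) le_rfl
        push_cast at *
        rcases hlast with h4 | h4
        · exact (hne (by rw [h4, h3, h2]; ring)).elim
        · rw [h4, h3]; ring

/-- The finite labelled graph formed by the first `N` blocks of `x` to the right of `m`. -/
def segmentGraph (x : ℤ → Block) (m : ℤ) (N : ℕ) : LabelledGraph (Fin (N + 1)) where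
  Adj s u v := (blockGraphOn (Set.Ico m (m + N)) x).Adj s (m + u) (m + v)
  symm s _ _ := (blockGraphOn (Set.Ico m (m + N)) x).symm s _ _

theorem segmentGraph_adj_succ {x : ℤ → Block} {m : ℤ} {N t : ℕ} (ht : t < N) {s : Gen}
    (hs : (x (m + t)).Joins s) :
    (segmentGraph x m N).Adj s ⟨t, by omega⟩ ⟨t + 1, by omega⟩ :=
  ⟨m + t, ⟨by omega, by omega⟩, Or.inl ⟨hs, Or.inl ⟨rfl, by push_cast; ring⟩⟩⟩

theorem segmentGraph_connected (x : ℤ → Block) (m : ℤ) (N : ℕ) :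
    (segmentGraph x m N).Connected := by
  have h0 : ∀ t (ht : t < N + 1),
      Relation.ReflTransGen (fun u v => ∃ s, (segmentGraph x m N).Adj s u v) 0 ⟨t, ht⟩ := by
    intro t
    induction t with
    | zero => exact fun _ => Relation.ReflTransGen.refl
    | succ t ih =>
      intro ht
      obtain ⟨s, hs⟩ := (x (m + t)).exists_joins
      exact (ih (by omega)).tail ⟨s, segmentGraph_adj_succ (by omega) hs⟩
  have : Std.Symm fun u v => ∃ s, (segmentGraph x m N).Adj s u v :=
    ⟨fun u v ⟨s, hs⟩ => ⟨s, (segmentGraph x m N).symm s u v hs⟩⟩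
  exact ⟨⟨0⟩, fun u v => (Relation.ReflTransGen.stdSymm.symm _ _ (h0 u u.2)).trans (h0 v v.2)⟩

theorem blockGraphOn_mono {I J : Set ℤ} (h : I ⊆ J) {x : ℤ → Block} {s : Gen} {i j : ℤ}
    (hadj : (blockGraphOn I x).Adj s i j) : (blockGraphOn J x).Adj s i j := by
  obtain ⟨n, hn, h2⟩ := hadj
  exact ⟨n, h hn, h2⟩

theorem segmentGraph_appearsIn (x : ℤ → Block) (m : ℤ) (N : ℕ) :
    (segmentGraph x m N).AppearsIn (blockGraph x) :=
  ⟨fun u => m + u, fun u v h => Fin.ext (by simpa using h),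
    fun _ _ _ h => blockGraphOn_mono (Set.subset_univ _) h⟩

theorem joins_of_adj_succ {I : Set ℤ} {x : ℤ → Block} {s : Gen} {i : ℤ}
    (h : (blockGraphOn I x).Adj s i (i + 1)) : i ∈ I ∧ (x i).Joins s := by
  obtain ⟨n, hn, ⟨h, ⟨rfl, -⟩ | ⟨rfl, h2⟩⟩ | ⟨-, h, -⟩⟩ := h
  · exact ⟨hn, h⟩
  · omega
  · omega

/-- A segment that appears in the half-line graph of `y` is a segment of `y`, up to reversal. -/
theorem segment_eq_of_appearsIn {x y : ℤ → Block} {m : ℤ} {N : ℕ} {e : Fin (N + 1) → ℤ}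
    (he : Function.Injective e) (hadj : ∀ s u v, (segmentGraph x m N).Adj s u v →
      (blockGraphOn (Set.Ici 0) y).Adj s (e u) (e v)) :
    (∃ p : ℤ, ∀ t : ℕ, t < N → 0 ≤ p + t ∧ x (m + t) = y (p + t)) ∨
      ∃ p : ℤ, ∀ t : ℕ, t < N → 0 ≤ p - t ∧ x (m + t) = y (p - t) := by
  let g : ℕ → ℤ := fun t => if h : t < N + 1 then e ⟨t, h⟩ else 0
  have hg : ∀ t (h : t < N + 1), g t = e ⟨t, h⟩ := fun t h => dif_pos h
  have hg2 : ∀ t < N, ∀ s, (x (m + t)).Joins s →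
      (blockGraphOn (Set.Ici 0) y).Adj s (g t) (g (t + 1)) := by
    intro t ht s hs
    rw [hg t (by omega), hg (t + 1) (by omega)]
    exact hadj s _ _ (segmentGraph_adj_succ ht hs)
  rcases eq_add_or_eq_sub_of_injective (g := g) (N := N) (fun s hs t ht h => by
      rw [hg s (by omega), hg t (by omega)] at h
      exact congrArg Fin.val (he h)) (fun t ht => by
      have hne : g t ≠ g (t + 1) := fun h => by
        rw [hg t (by omega), hg (t + 1) (by omega)] at h
        have := congrArg Fin.val (he h)
        simp at this
      obtain ⟨s, hs⟩ := (x (m + t)).exists_joins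
      obtain ⟨n, -, ⟨-, h⟩ | ⟨-, h, -⟩⟩ := hg2 t ht s hs
      · omega
      · exact (hne h).elim) with h | h
  · refine Or.inl ⟨g 0, fun t ht => ?_⟩
    have h1 : ∀ s, (x (m + t)).Joins s → g 0 + t ∈ Set.Ici (0 : ℤ) ∧ (y (g 0 + t)).Joins s := by
      intro s hs
      have := hg2 t ht s hs
      rw [h t (by omega), h (t + 1) (by omega)] at this
      push_cast at this
      rw [← add_assoc] at this
      exact joins_of_adj_succ this
    obtain ⟨s, hs⟩ := (x (m + t)).exists_joins
    exact ⟨(h1 s hs).1, Block.eq_of_joins_imp fun s hs => (h1 s hs).2⟩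
  -- Blocks are indexed by their left end; when the walk runs leftwards, this is the later vertex `g
  -- 0 - (t + 1)`.
  · refine Or.inr ⟨g 0 - 1, fun t ht => ?_⟩
    have h1 : ∀ s, (x (m + t)).Joins s →
        g 0 - 1 - t ∈ Set.Ici (0 : ℤ) ∧ (y (g 0 - 1 - t)).Joins s := by
      intro s hs
      have := (blockGraphOn (Set.Ici 0) y).symm _ _ _ (hg2 t ht s hs)
      rw [h t (by omega), h (t + 1) (by omega)] at this
      refine joins_of_adj_succ ?_
      convert this using 1 <;> push_cast <;> ring
    obtain ⟨s, hs⟩ := (x (m + t)).exists_joins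
    exact ⟨(h1 s hs).1, Block.eq_of_joins_imp fun s hs => (h1 s hs).2⟩

/-! ### The set `X_ω` in terms of Toeplitz windows and of cluster points -/

theorem subshiftSet_subset (ω : Omega) (i : Fin 3) : subshiftSet ω ⊆ toeplitzSet ω i := by
  intro x hx L B
  obtain ⟨F, -, hF⟩ := toeplitz_extendsSchreierGraph ω i
  obtain ⟨f, hf, hadj⟩ := hx _ (segmentGraph x (-L) (2 * L + 1)) (segmentGraph_connected _ _ _)
    (segmentGraph_appearsIn _ _ _)
  have key := segment_eq_of_appearsIn (x := x) (y := toeplitz ω i) (m := -L) (N := 2 * L + 1)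
    (e := fun u => (F.symm (f u) : ℤ))
    (fun u v h => hf (F.symm.injective (Nat.cast_injective h)))
    (fun s u v h => by
      rw [hF]
      simpa using hadj s u v h)
  suffices h : ∃ n : ℤ, ∀ j : ℤ, |j| ≤ L → n + j ≠ -1 ∧ x j = toeplitz ω i (n + j) by
    obtain ⟨n, hn⟩ := h
    obtain ⟨k, hk, h⟩ := exists_far_window ω i L n B fun j hj => (hn j hj).1
    exact ⟨k, hk, fun j hj => (hn j hj).2.trans (h j hj).symm⟩
  rcases key with ⟨p, hp⟩ | ⟨p, hp⟩
  · refine ⟨p + L, fun j hj => ?_⟩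
    rw [abs_le] at hj
    obtain ⟨h1, h2⟩ := hp (j + L).toNat (by omega)
    rw [Int.toNat_of_nonneg (by omega)] at h1 h2
    rw [show -(L : ℤ) + (j + L) = j by ring] at h2
    exact ⟨by omega, h2.trans (by congr 1; ring)⟩
  -- A reversed occurrence in the half-line reflects to a forward one at positions at most `-2`,
  -- which again misses the hole and can be moved far to the right.
  · refine ⟨-2 - p + L, fun j hj => ?_⟩
    rw [abs_le] at hj
    obtain ⟨h1, h2⟩ := hp (j + L).toNat (by omega)
    rw [Int.toNat_of_nonneg (by omega)] at h1 h2
    rw [show -(L : ℤ) + (j + L) = j by ring, ← toeplitz_symm] at h2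
    exact ⟨by omega, h2.trans (by congr 1; ring)⟩

theorem toeplitzSet_subset (ω : Omega) (i : Fin 3) : toeplitzSet ω i ⊆ subshiftSet ω := by
  rintro x hx k P - ⟨f, hf, hadj⟩
  obtain ⟨F, -, hF⟩ := toeplitz_extendsSchreierGraph ω i
  obtain ⟨L, hL⟩ := (Set.finite_range fun u => (f u).natAbs).bddAbove
  have hL : ∀ u, |f u| ≤ L := fun u => by
    have := hL (Set.mem_range_self u)
    rw [abs_le]
    omega
  -- An edge at a vertex in `[-L, L]` may belong to the block `-L - 1`, hence the radius `L + 1`;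
  -- the bound on `n` keeps the pattern inside the half-line.
  obtain ⟨n, hn, h⟩ := hx (L + 1) (L + 1)
  have hpos : ∀ u, ((f u + n).toNat : ℤ) = f u + n := fun u =>
    Int.toNat_of_nonneg (by have := abs_le.1 (hL u); omega)
  refine ⟨fun u => F (f u + n).toNat, fun u v huv => hf ?_, fun s u v huv => ?_⟩
  · have h1 := congrArg (Nat.cast : ℕ → ℤ) (F.injective huv)
    rw [hpos, hpos] at h1
    omega
  · rw [← hF, hpos, hpos]
    obtain ⟨m, -, hm⟩ := hadj s u v huv
    have hu := abs_le.1 (hL u)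
    have hmL : |m| ≤ (L + 1 : ℕ) := by
      rw [abs_le]
      push_cast
      omega
    refine ⟨n + m, show 0 ≤ n + m by rw [abs_le] at hmL; push_cast at hmL; omega, ?_⟩
    rw [← h m hmL]
    refine hm.imp (And.imp_right ?_) (And.imp_right ?_) <;> omega

theorem subshiftSet_eq (ω : Omega) (i : Fin 3) : subshiftSet ω = toeplitzSet ω i :=
  (subshiftSet_subset ω i).antisymm (toeplitzSet_subset ω i)

theorem toeplitzSet_eq_setOf_mapClusterPt {ω : Omega} {y : ℤ → Block}
    (hy : ExtendsSchreierGraph ω y) (i : Fin 3) :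
    toeplitzSet ω i = {x | MapClusterPt x Filter.atTop fun n : ℕ => (shift Block ^ n) y} := by
  have hyt := fun n hn => hy.eq_of_nonneg (toeplitz_extendsSchreierGraph ω i) (n := n) hn
  have hsh : ∀ (n : ℕ) (j : ℤ), (shift Block ^ n) y j = y (j + n) := fun n j => by
    rw [← zpow_natCast, shift_zpow_apply]
  ext x
  change _ ↔ MapClusterPt x _ _
  rw [(hasBasis_nhds_window x).mapClusterPt_iff_frequently]
  simp only [Filter.frequently_atTop, forall_const]
  constructor
  · intro hx L N
    obtain ⟨n, hn, h⟩ := hx L (N + L)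
    refine ⟨n.toNat, by omega, fun j hj => ?_⟩
    rw [abs_le] at hj
    rw [hsh, Int.toNat_of_nonneg (by omega), h j (abs_le.2 hj), hyt _ (by omega), add_comm]
  · intro hx L B
    obtain ⟨n, hn, h⟩ := hx L (B.toNat + L)
    refine ⟨n, by omega, fun j hj => ?_⟩
    have := h j hj
    rw [abs_le] at hj
    rw [← this, hsh, hyt _ (by omega), add_comm]

/-! ### Elements of topological full groups -/

theorem continuous_zpow_apply {X : Type*} [TopologicalSpace X] (φ : X ≃ₜ X) {n : X → ℤ}
    (hn : Continuous n) : Continuous fun x => (φ ^ n x) x := by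
  rw [continuous_iff_continuousAt]
  intro x
  have h : ∀ᶠ z in 𝓝 x, n z = n x :=
    hn.continuousAt.eventually (IsOpen.mem_nhds (isOpen_discrete {n x}) rfl)
  refine ((φ ^ n x).continuous.continuousAt).congr ?_
  filter_upwards [h] with z hz
  rw [hz]

/-- The element of the topological full group given by an involutive cocycle. -/
def fullGroupOfInvolutive {X : Type*} [TopologicalSpace X] (φ : X ≃ₜ X) (n : X → ℤ)
    (hn : Continuous n) (hinv : Function.Involutive fun x => (φ ^ n x) x) : fullGroup φ :=
  ⟨{ toEquiv := hinv.toPerm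
     continuous_toFun := continuous_zpow_apply φ hn
     continuous_invFun := continuous_zpow_apply φ hn }, n, hn, fun _ => rfl⟩

/-- In a minimal system on an infinite Hausdorff space the powers act freely. -/
theorem IsMinimalSystem.zpow_apply_eq_self {X : Type*} [TopologicalSpace X] [T1Space X]
    [Infinite X] {φ : X ≃ₜ X} (hφ : IsMinimalSystem φ) {k : ℤ} {x : X}
    (h : (φ ^ k) x = x) : k = 0 := by
  by_contra hk
  have hper : ∀ m : ℤ, (φ ^ (k * m)) x = x := by
    intro m
    rw [zpow_mul]
    induction m with
    | zero => simp
    | succ m ih =>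
      rw [zpow_add_one]
      change ((φ ^ k) ^ (m : ℤ)) ((φ ^ k) x) = x
      rw [h, ih]
    | pred m ih =>
      rw [zpow_sub_one]
      change ((φ ^ k) ^ (-m : ℤ)) ((φ ^ k).symm x) = x
      rw [(φ ^ k).symm_apply_eq.2 h.symm, ih]
  have hsub : (Set.range fun n : ℤ => (φ ^ n) x) ⊆
      (fun n : ℤ => (φ ^ n) x) '' Set.Ico 0 |k| := by
    rintro _ ⟨n, rfl⟩
    refine ⟨n % k, ⟨Int.emod_nonneg _ hk, Int.emod_lt_abs _ hk⟩, ?_⟩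
    change (φ ^ (n % k)) x = (φ ^ n) x
    conv_rhs => rw [← Int.emod_add_mul_ediv n k, zpow_add]
    change _ = (φ ^ (n % k)) ((φ ^ (k * (n / k))) x)
    rw [hper]
  have hfin := ((Set.finite_Ico 0 |k|).image fun n : ℤ => (φ ^ n) x).subset hsub
  have huniv : (Set.range fun n : ℤ => (φ ^ n) x) = Set.univ := by
    rw [← (hφ.2 x).closure_eq, hfin.isClosed.closure_eq]
  rw [huniv] at hfin
  exact Set.infinite_univ hfin

/-! ### The Toeplitz subshift -/

/-- The Toeplitz subshift. -/
def toeplitzSubshift (ω : Omega) (i : Fin 3) : Subshift Block where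
  carrier := toeplitzSet ω i
  isClosed := isClosed_toeplitzSet ω i
  shift_mem_iff x := ⟨fun h => toeplitzSet_shift h 1 fun _ => rfl,
    fun h => toeplitzSet_shift h (-1) fun n => by
      change x n = x (n + -1 + 1)
      rw [neg_add_cancel_right]⟩

theorem toeplitzSubshift_isMinimalSystem {ω : Omega} {i : Fin 3} (h : ∀ N, ∃ n ≥ N, ω n = i) :
    IsMinimalSystem (toeplitzSubshift ω i).map := by
  refine ⟨⟨toeplitz ω i, toeplitz_mem_toeplitzSet h⟩, fun x z => ?_⟩
  rw [closure_subtype, mem_closure_iff_nhds_basis (hasBasis_nhds_window _)]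
  intro L _
  obtain ⟨k, hk⟩ := toeplitzSet_recurrent x.2 z.2 L
  refine ⟨_, ⟨_, ⟨k, rfl⟩, rfl⟩, fun j hj => ?_⟩
  rw [Subshift.coe_map_zpow, shift_zpow_apply, hk j hj]

/-- Both sides equal `subshiftSet ω`, which does not involve a filling. -/
theorem toeplitzSet_fill (ω : Omega) (i j : Fin 3) : toeplitzSet ω i = toeplitzSet ω j := by
  rw [← subshiftSet_eq, ← subshiftSet_eq]

/-- Both fillings of the hole belong to the set. If it were finite, shift invariance would make them
periodic with a common period `p * q`; they agree at `-1 + p * q`, hence would agree at the hole. -/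
theorem toeplitzSet_infinite {ω : Omega} {i j : Fin 3} (hi : ∀ N, ∃ n ≥ N, ω n = i)
    (hj : ∀ N, ∃ n ≥ N, ω n = j) (hij : i ≠ j) : (toeplitzSet ω i).Infinite := by
  intro hfin
  have hper : ∀ x ∈ toeplitzSet ω i, ∃ p > 0, ∀ n, x (n + p) = x n := by
    intro x hx
    have hmaps : Set.MapsTo (fun (k : ℕ) (n : ℤ) => x (n + k)) Set.univ (toeplitzSet ω i) :=
      fun k _ => toeplitzSet_shift hx k fun _ => rfl
    obtain ⟨k, -, l, -, hkl, h⟩ := Set.infinite_univ.exists_lt_map_eq_of_mapsTo hmaps hfin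
    refine ⟨(l : ℤ) - k, by omega, fun n => ?_⟩
    have := congrFun h (n - k)
    simp only [sub_add_cancel] at this
    rw [this]
    congr 1
    ring
  have hmul : ∀ {x : ℤ → Block} {p : ℤ}, (∀ n, x (n + p) = x n) →
      ∀ (m : ℕ) n, x (n + m * p) = x n := by
    intro x p hp m
    induction m with
    | zero => simp
    | succ m ih =>
      intro n
      rw [show n + (m + 1 : ℕ) * p = n + m * p + p by push_cast; ring, hp, ih]
  obtain ⟨p, hp0, hp⟩ := hper _ (toeplitz_mem_toeplitzSet hi)
  obtain ⟨q, hq0, hq⟩ := hper _ (toeplitzSet_fill ω j i ▸ toeplitz_mem_toeplitzSet hj)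
  lift p to ℕ using hp0.le
  lift q to ℕ using hq0.le
  have h1 := hmul hp q (-1)
  have h2 := hmul hq p (-1)
  have hpq : (0 : ℤ) < p * q := mul_pos hp0 hq0
  rw [mul_comm, toeplitz_fill ω i j (by omega), h2, toeplitz_neg_one, toeplitz_neg_one] at h1
  exact hij (Block.lam.inj h1).symm

theorem continuous_move_zero {ω : Omega} {i : Fin 3} (s : Gen) :
    Continuous fun x : (toeplitzSubshift ω i).carrier => move x.1 s 0 := by
  have h : Continuous fun p : Block × Block => 0 + step p.1 p.2 s := continuous_of_discreteTopology
  have h2 : ∀ n : ℤ, Continuous fun x : (toeplitzSubshift ω i).carrier => x.1 n :=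
    fun n => (continuous_apply n).comp continuous_subtype_val
  exact h.comp ((h2 (0 - 1)).prodMk (h2 0))

theorem move_shift (x : ℤ → Block) (s : Gen) (k n : ℤ) :
    move ((shift Block ^ k) x) s n = move x s (n + k) - k := by
  simp only [move, shift_zpow_apply]
  rw [sub_add_eq_add_sub]
  ring

theorem vertexAct_shift {x z : ℤ → Block} (hx : Alternating x) (hz : Alternating z) {k : ℤ}
    (h : z = (shift Block ^ k) x) (w : FreeGroup Gen) (n : ℤ) :
    vertexAct hz w n = vertexAct hx w (n + k) - k := by
  obtain ⟨L, -, hL⟩ := vertexAct_local w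
  have := hL z x hz hx n (n + k) fun j _ => by
    rw [h, shift_zpow_apply]
    congr 1
    ring
  omega

/-- The element of the topological full group of the Toeplitz subshift that moves along the edge
with a given label. -/
noncomputable def edgeMap (ω : Omega) (i : Fin 3) (s : Gen) :
    fullGroup (toeplitzSubshift ω i).map :=
  fullGroupOfInvolutive _ (fun x => move x.1 s 0) (continuous_move_zero s) fun x => by
    -- After the shift the origin is the other end of the same edge, so the displacement there is
    -- the opposite one and the map is an involution.
    have h := move_shift x.1 s (move x.1 s 0) 0
    rw [← Subshift.coe_map_zpow] at h
    rw [zero_add, move_involutive (toeplitzSet_alternating x.2), zero_sub] at h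
    simp only [h, zpow_neg]
    exact ((toeplitzSubshift ω i).map ^ move x.1 s 0).symm_apply_apply x

theorem edgeMap_apply (ω : Omega) (i : Fin 3) (s : Gen) (x : (toeplitzSubshift ω i).carrier) :
    (edgeMap ω i s).1 x = ((toeplitzSubshift ω i).map ^ move x.1 s 0) x := rfl

/-- The action of words on the Toeplitz subshift. -/
noncomputable def subshiftAct (ω : Omega) (i : Fin 3) :
    FreeGroup Gen →* fullGroup (toeplitzSubshift ω i).map :=
  FreeGroup.lift (edgeMap ω i)

theorem subshiftAct_apply (ω : Omega) (i : Fin 3) (w : FreeGroup Gen)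
    (x : (toeplitzSubshift ω i).carrier) :
    (subshiftAct ω i w).1 x =
      ((toeplitzSubshift ω i).map ^ vertexAct (toeplitzSet_alternating x.2) w 0) x := by
  have hof : ∀ s, subshiftAct ω i (FreeGroup.of s) = edgeMap ω i s := fun s => by
    simp [subshiftAct]
  induction w using FreeGroup.induction_on generalizing x with
  | C1 => simp
  | of s => rw [vertexAct_of, hof, edgeMap_apply]
  | inv_of s _ =>
    rw [vertexAct_of_inv, map_inv, hof]
    rfl
  | mul v w hv hw =>
    rw [map_mul, map_mul]
    change (subshiftAct ω i v).1 ((subshiftAct ω i w).1 x) =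
      ((toeplitzSubshift ω i).map ^ (vertexAct (toeplitzSet_alternating x.2) v
        (vertexAct (toeplitzSet_alternating x.2) w 0))) x
    have h := vertexAct_shift (toeplitzSet_alternating x.2)
      (toeplitzSet_alternating ((subshiftAct ω i w).1 x).2) (by
        rw [hw, Subshift.coe_map_zpow]) v 0
    rw [hv, h, hw]
    rw [zero_add, ← Homeomorph.mul_apply, ← zpow_add, sub_add_cancel]

/-- The window of a point `x` at the origin occurs far to the right in the Toeplitz line, where a
trivial word fixes vertices; by locality it fixes `x`. Conversely, a word acting trivially fixes
every shift of the Toeplitz sequence, and freeness of the shift makes each vertex displacement zero.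
-/
theorem treeAct_eq_one_iff_subshiftAct {ω : Omega} {i j : Fin 3} (hi : ∀ N, ∃ n ≥ N, ω n = i)
    (hj : ∀ N, ∃ n ≥ N, ω n = j) (hij : i ≠ j) (w : FreeGroup Gen) :
    treeAct ω w = 1 ↔ subshiftAct ω i w = 1 := by
  rw [treeAct_eq_one_iff ω i]
  constructor
  · rintro ⟨B, hB⟩
    refine Subtype.ext (Homeomorph.ext fun x => ?_)
    rw [subshiftAct_apply]
    obtain ⟨L, -, hL⟩ := vertexAct_local w
    obtain ⟨n, hn, h⟩ := x.2 L B
    have := hL x.1 (toeplitz ω i) (toeplitzSet_alternating x.2) (toeplitz_alternating ω i) 0 n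
      fun j hj => by rw [zero_add, h j hj]
    rw [hB n hn, sub_self, sub_zero] at this
    rw [this]
    rfl
  · intro h
    have : Infinite (toeplitzSubshift ω i).carrier :=
      (toeplitzSet_infinite hi hj hij).to_subtype
    refine ⟨0, fun n _ => ?_⟩
    let x : (toeplitzSubshift ω i).carrier :=
      ((toeplitzSubshift ω i).map ^ n) ⟨toeplitz ω i, toeplitz_mem_toeplitzSet hi⟩
    have h1 := subshiftAct_apply ω i w x
    rw [h] at h1
    have h2 := (toeplitzSubshift_isMinimalSystem hi).zpow_apply_eq_self h1.symm
    rw [vertexAct_shift (toeplitz_alternating ω i) (k := n) _ (Subshift.coe_map_zpow _ _ _)] at h2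
    rw [zero_add] at h2
    omega

theorem exists_labels_of_not_eventuallyConstant {ω : Omega} (hω : ¬ EventuallyConstant ω) :
    ∃ i j : Fin 3, i ≠ j ∧ (∀ N, ∃ n ≥ N, ω n = i) ∧ ∀ N, ∃ n ≥ N, ω n = j := by
  obtain ⟨i, hi⟩ : ∃ i, ∀ N, ∃ n ≥ N, ω n = i := by
    by_contra! h
    choose N hN using h
    -- The sum serves as a common upper bound of the thresholds of the three values.
    exact hN (ω (∑ i, N i)) _ (Finset.single_le_sum (f := N) (fun _ _ => Nat.zero_le _)
      (Finset.mem_univ _)) rfl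
  obtain ⟨j, hj⟩ : ∃ j, ∀ N, ∃ n ≥ N, ω n = j ∧ j ≠ i := by
    by_contra! h
    choose N hN using h
    refine hω ?_
    obtain ⟨M, hM, hMi⟩ := hi (∑ i, N i)
    refine ⟨M, fun n hn => ?_⟩
    rw [hMi]
    exact hN (ω n) n ((Finset.single_le_sum (f := N) (fun _ _ => Nat.zero_le _)
      (Finset.mem_univ _)).trans (hM.trans hn)) rfl
  exact ⟨i, j, fun h => by obtain ⟨n, -, -, h2⟩ := hj 0; exact h2 h.symm, hi,
    fun N => (hj N).imp fun n hn => ⟨hn.1, hn.2.1⟩⟩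

/-- The embedding of the Grigorchuk group when the parameter is not eventually constant. -/
theorem exists_subshift_embedding {ω : Omega} (hω : ¬ EventuallyConstant ω) :
    ∃ Y : Subshift Block, Y.carrier = subshiftSet ω ∧ Y.carrier.Infinite ∧
      IsMinimalSystem Y.map ∧ ∃ ι : grigorchukGroup ω →* fullGroup Y.map, Function.Injective ι ∧
        ∀ (s : Gen) (x : Y.carrier),
          (∃! m : ℤ, (blockGraph x).Adj s 0 m) ∧
          ((blockGraph x).Adj s 0 1 → (ι (gen ω s)).1 x = Y.map x) ∧
          ((blockGraph x).Adj s 0 (-1) → (ι (gen ω s)).1 x = Y.map.symm x) ∧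
          ((blockGraph x).Adj s 0 0 → (ι (gen ω s)).1 x = x) := by
  obtain ⟨i, j, hij, hi, hj⟩ := exists_labels_of_not_eventuallyConstant hω
  obtain ⟨ι, hι, hιw⟩ := exists_injective_hom_of_ker ω (subshiftAct ω i)
    (treeAct_eq_one_iff_subshiftAct hi hj hij)
  refine ⟨toeplitzSubshift ω i, (subshiftSet_eq ω i).symm, toeplitzSet_infinite hi hj hij,
    toeplitzSubshift_isMinimalSystem hi, ι, hι, fun s x => ?_⟩
  have hs : ι (gen ω s) = edgeMap ω i s := by
    have := hιw (FreeGroup.of s)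
    simpa [wordEval, subshiftAct] using this
  have hx := toeplitzSet_alternating x.2
  simp only [blockGraph_adj_iff hx, hs, edgeMap_apply]
  refine ⟨⟨_, rfl, fun _ h => h.symm⟩, fun h => ?_, fun h => ?_, fun h => ?_⟩
  · rw [h, zpow_one]
  · rw [h, zpow_neg_one]
    rfl
  · rw [h, zpow_zero]
    rfl

/-! ### The action of `ℤⁿ ⋊ Sₙ` on a tower -/

/-- The action of `ℤⁿ ⋊ Sₙ` on `n` copies of a set with a permutation `T`. -/
def towerAct {U : Type*} (T : Equiv.Perm U) (n : ℕ) : IntWreath n →* Equiv.Perm (Fin n × U) :=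
  MonoidHom.toHomPerm
    -- The permutation acts before the translations, so the exponent is read at the floor of
    -- arrival.
    { toFun g p := (g.right p.1, (T ^ (g.left (g.right p.1)).toAdd) p.2)
      map_one' := rfl
      map_mul' g h := by
        funext p
        change (_, _) = (_, _)
        refine Prod.ext rfl ?_
        have h1 : (g * h).left (g.right (h.right p.1)) =
            g.left (g.right (h.right p.1)) * h.left (h.right p.1) := by
          change _ * h.left (g.right.symm (g.right (h.right p.1))) = _
          rw [Equiv.symm_apply_apply]
        change (T ^ ((g * h).left (g.right (h.right p.1))).toAdd) p.2 = _
        rw [h1, toAdd_mul, zpow_add]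
        rfl }

theorem towerAct_apply {U : Type*} (T : Equiv.Perm U) {n : ℕ} (g : IntWreath n) (i : Fin n)
    (u : U) : towerAct T n g (i, u) = (g.right i, (T ^ (g.left (g.right i)).toAdd) u) := rfl

theorem towerAct_injective {U : Type*} [Nonempty U] {T : Equiv.Perm U}
    (hT : ∀ (k : ℤ) u, (T ^ k) u = u → k = 0) (n : ℕ) : Function.Injective (towerAct T n) := by
  rw [injective_iff_map_eq_one]
  intro g hg
  obtain ⟨u⟩ := ‹Nonempty U›
  have h : ∀ i, g.right i = i ∧ (T ^ (g.left (g.right i)).toAdd) u = u := fun i => by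
    have := towerAct_apply T g i u
    rw [hg] at this
    exact ⟨(congrArg Prod.fst this).symm, (congrArg Prod.snd this).symm⟩
  refine SemidirectProduct.ext (funext fun i => ?_) (Equiv.ext fun i => (h i).1)
  have h2 := hT _ _ (h i).2
  rw [(h i).1] at h2
  exact h2

/-! ### First return maps -/

section FirstReturn

variable {X : Type*} [TopologicalSpace X]

/-- Every point returns to `U` under forward iteration of `φ`. -/
def Recurrent (φ : X ≃ₜ X) (U : Set X) : Prop := ∀ x, ∃ k : ℕ, 0 < k ∧ (φ ^ k) x ∈ U

open Classical in
/-- The first return time. -/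
noncomputable def returnTime {φ : X ≃ₜ X} {U : Set X} (h : Recurrent φ U) (x : X) : ℕ :=
  Nat.find (h x)

/-- An earlier backward return from the first return point would be an earlier forward return of
`x`. This makes the forward and backward return maps inverse to each other. -/
theorem returnTime_inv {φ ψ : X ≃ₜ X} {U : Set X} (h : Recurrent φ U) (h' : Recurrent ψ U)
    (hψ : ψ = φ⁻¹) {x : X} (hx : x ∈ U) :
    returnTime h' ((φ ^ returnTime h x) x) = returnTime h x := by
  classical
  subst hψ
  have hk := Nat.find_spec (h x)
  have hmin : ∀ m < returnTime h x, ¬ (0 < m ∧ (φ ^ m) x ∈ U) := fun m hm => Nat.find_min (h x) hm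
  change 0 < returnTime h x ∧ _ at hk
  have key : ∀ m ≤ returnTime h x, ((φ⁻¹ : X ≃ₜ X) ^ m) ((φ ^ returnTime h x) x) =
      (φ ^ (returnTime h x - m)) x := by
    intro m hm
    rw [← Homeomorph.mul_apply, pow_sub _ hm, ← inv_pow,
      ((Commute.refl φ).inv_left.pow_pow _ _).eq]
  unfold returnTime at *
  rw [Nat.find_eq_iff]
  refine ⟨⟨hk.1, ?_⟩, fun m hm => ?_⟩
  · rw [key _ le_rfl, Nat.sub_self]
    exact hx
  · rintro ⟨hm0, hm1⟩
    rw [key _ hm.le] at hm1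
    exact hmin _ (by omega) ⟨by omega, hm1⟩

/-- The first return map. -/
noncomputable def firstReturn {φ : X ≃ₜ X} {U : Set X} (h : Recurrent φ U)
    (h' : Recurrent φ⁻¹ U) : Equiv.Perm U where
  toFun u := ⟨(φ ^ returnTime h u) u, by classical exact (Nat.find_spec (h u)).2⟩
  invFun u := ⟨((φ⁻¹ : X ≃ₜ X) ^ returnTime h' u) u, by
    classical exact (Nat.find_spec (h' u)).2⟩
  left_inv u := by
    apply Subtype.ext
    simp only [returnTime_inv h h' rfl u.2]
    rw [← Homeomorph.mul_apply, inv_pow, inv_mul_cancel, Homeomorph.one_apply]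
  right_inv u := by
    apply Subtype.ext
    simp only [returnTime_inv h' h (inv_inv φ).symm u.2]
    rw [← Homeomorph.mul_apply, inv_pow, mul_inv_cancel, Homeomorph.one_apply]

theorem coe_firstReturn {φ : X ≃ₜ X} {U : Set X} (h : Recurrent φ U) (h' : Recurrent φ⁻¹ U)
    (u : U) : (firstReturn h h' u : X) = (φ ^ returnTime h u) u := rfl

/-- The `m`-th return is a power `φ ^ N` with `N ≥ m`, as each return time is positive. -/
theorem firstReturn_free {φ : X ≃ₜ X} {U : Set X} (h : Recurrent φ U) (h' : Recurrent φ⁻¹ U)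
    (hfree : ∀ (k : ℤ) x, (φ ^ k) x = x → k = 0) (k : ℤ) (u : U)
    (hk : (firstReturn h h' ^ k) u = u) : k = 0 := by
  have key : ∀ m : ℕ, ∃ N : ℕ, m ≤ N ∧ ((firstReturn h h' ^ m) u : X) = (φ ^ N) u := by
    intro m
    induction m with
    | zero => exact ⟨0, le_rfl, rfl⟩
    | succ m ih =>
      obtain ⟨N, hN, hm⟩ := ih
      have h1 : 0 < returnTime h ((φ ^ N) (u : X)) := by
        classical exact (Nat.find_spec (h ((φ ^ N) (u : X)))).1
      refine ⟨returnTime h ((φ ^ N) (u : X)) + N, by omega, ?_⟩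
      rw [pow_succ', Equiv.Perm.mul_apply, coe_firstReturn, hm, pow_add]
      rfl
  have hnat : ∀ m : ℕ, (firstReturn h h' ^ m) u = u → m = 0 := by
    intro m hm
    obtain ⟨N, hN, h1⟩ := key m
    rw [hm] at h1
    have := hfree N u (by rw [zpow_natCast]; exact h1.symm)
    omega
  obtain ⟨m, rfl | rfl⟩ := k.eq_nat_or_neg
  · rw [zpow_natCast] at hk
    simpa using hnat m hk
  · rw [zpow_neg, zpow_natCast, Equiv.Perm.inv_eq_iff_eq] at hk
    simpa using hnat m hk.symm

/-! ### Maps that are locally powers of a homeomorphism -/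

/-- A map from `U` to `X` that locally coincides with powers of `φ`. -/
def LocallyPower (φ : X ≃ₜ X) {U : Set X} (S : U → X) : Prop :=
  ∀ u, ∃ k : ℤ, ∀ᶠ z in 𝓝 u, S z = (φ ^ k) z

theorem LocallyPower.continuous {φ : X ≃ₜ X} {U : Set X} {S : U → X} (hS : LocallyPower φ S) :
    Continuous S := by
  rw [continuous_iff_continuousAt]
  intro u
  obtain ⟨k, hk⟩ := hS u
  exact ((φ ^ k).continuous.comp continuous_subtype_val).continuousAt.congr
    (hk.mono fun _ h => h.symm)

theorem LocallyPower.comp {φ : X ≃ₜ X} {U : Set X} {S T : U → U}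
    (hS : LocallyPower φ fun u => (S u : X)) (hT : LocallyPower φ fun u => (T u : X)) :
    LocallyPower φ fun u => (S (T u) : X) := by
  intro u
  obtain ⟨k, hk⟩ := hT u
  obtain ⟨l, hl⟩ := hS (T u)
  have hTc : Continuous T := continuous_induced_rng.2 hT.continuous
  refine ⟨l + k, ?_⟩
  filter_upwards [hk, hTc.continuousAt.eventually hl] with z h1 h2
  rw [h2, h1, zpow_add]
  rfl

/-- The return time is locally constant: hitting `U` is an open condition, and so is avoiding it at
finitely many earlier times, `U` being clopen. -/
theorem locallyPower_return {φ : X ≃ₜ X} {U : Set X} (hU : IsClopen U) (h : Recurrent φ U) :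
    LocallyPower φ fun u : U => (φ ^ returnTime h u) (u : X) := by
  classical
  intro u
  refine ⟨returnTime h u, ?_⟩
  have hopen : ∀ m : ℕ, Continuous fun z : U => (φ ^ m) (z : X) := fun m =>
    (φ ^ m).continuous.comp continuous_subtype_val
  have h1 : ∀ᶠ z : U in 𝓝 u, (φ ^ returnTime h u) (z : X) ∈ U :=
    (hopen _).continuousAt.eventually (hU.2.mem_nhds (Nat.find_spec (h u)).2)
  have h2 : ∀ᶠ z : U in 𝓝 u, ∀ m ∈ Set.Iio (returnTime h u), ¬ (0 < m ∧ (φ ^ m) (z : X) ∈ U) := by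
    rw [Filter.eventually_all_finite (Set.finite_Iio _)]
    intro m hm
    by_cases hm0 : 0 < m
    · have h3 : (φ ^ m) (u : X) ∈ Uᶜ := fun h3 => Nat.find_min (h u) hm ⟨hm0, h3⟩
      filter_upwards [(hopen m).continuousAt.eventually (hU.1.isOpen_compl.mem_nhds h3)] with z hz
      exact fun h4 => hz h4.2
    · exact Filter.Eventually.of_forall fun z hz => hm0 hz.1
  filter_upwards [h1, h2] with z hz1 hz2
  have : returnTime h z = returnTime h u :=
    (Nat.find_eq_iff _).2 ⟨⟨(Nat.find_spec (h u)).1, hz1⟩, hz2⟩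
  rw [this, zpow_natCast]

theorem locallyPower_inv {φ : X ≃ₜ X} {U : Set X} {S : U → X} (hS : LocallyPower φ⁻¹ S) :
    LocallyPower φ S := by
  intro u
  obtain ⟨k, hk⟩ := hS u
  refine ⟨-k, ?_⟩
  filter_upwards [hk] with z hz
  rw [hz, inv_zpow']

theorem locallyPower_firstReturn_zpow {φ : X ≃ₜ X} {U : Set X} (hU : IsClopen U)
    (h : Recurrent φ U) (h' : Recurrent φ⁻¹ U) (k : ℤ) :
    LocallyPower φ fun u => ((firstReturn h h' ^ k) u : X) := by
  have h1 : LocallyPower φ fun u => (firstReturn h h' u : X) := locallyPower_return hU h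
  have h2 : LocallyPower φ fun u => ((firstReturn h h')⁻¹ u : X) :=
    locallyPower_inv (locallyPower_return hU h')
  induction k with
  | zero => exact fun u => ⟨0, Filter.Eventually.of_forall fun z => rfl⟩
  | succ k ih =>
    simp only [zpow_add_one]
    exact ih.comp h1
  | pred k ih =>
    simp only [zpow_sub_one]
    exact ih.comp h2

/-- An action by maps that are locally powers of a freely acting homeomorphism is an action by
elements of the topological full group. -/
theorem exists_hom_fullGroup {G : Type*} [Group G] {φ : X ≃ₜ X}
    (hfree : ∀ (k : ℤ) x, (φ ^ k) x = x → k = 0) {j : G →* Equiv.Perm X}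
    (hj : ∀ g x, ∃ k : ℤ, ∀ᶠ z in 𝓝 x, j g z = (φ ^ k) z) (hinj : Function.Injective j) :
    ∃ ι : G →* fullGroup φ, Function.Injective ι := by
  have hcont : ∀ g, Continuous (j g) := fun g => by
    rw [continuous_iff_continuousAt]
    intro x
    obtain ⟨k, hk⟩ := hj g x
    exact (φ ^ k).continuous.continuousAt.congr (hk.mono fun _ h => h.symm)
  have hinv : ∀ g, (j g).symm = j g⁻¹ := fun g => by rw [map_inv]; rfl
  have hmem : ∀ g, ∃ n : X → ℤ, Continuous n ∧ ∀ x, j g x = (φ ^ n x) x := by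
    intro g
    choose n hn using hj g
    -- By freeness the exponent at a point is unique, so the exponents chosen at `x` and at a nearby
    -- `z` coincide.
    refine ⟨n, (IsLocallyConstant.iff_eventually_eq n).2 (fun x => ?_) |>.continuous,
      fun x => (hn x).self_of_nhds⟩
    filter_upwards [hn x] with z hz
    have h1 := (hn z).self_of_nhds
    rw [hz] at h1
    have h2 : (φ ^ (-n z + n x)) z = z := by
      rw [zpow_add, Homeomorph.mul_apply, h1, ← Homeomorph.mul_apply, zpow_neg, inv_mul_cancel,
        Homeomorph.one_apply]
    have := hfree _ _ h2
    omega
  refine ⟨{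
    toFun := fun g => ⟨{
      toEquiv := j g
      continuous_toFun := hcont g
      continuous_invFun := by
        change Continuous (j g).symm
        rw [hinv]
        exact hcont _ }, hmem g⟩
    map_one' := Subtype.ext (Homeomorph.ext fun x => by
      change j 1 x = x
      rw [map_one]
      rfl)
    map_mul' := fun g h => Subtype.ext (Homeomorph.ext fun x => by
      change j (g * h) x = j g (j h x)
      rw [map_mul]
      rfl) }, fun g h hgh => hinj (Equiv.ext fun x => ?_)⟩
  exact DFunLike.congr_fun (congrArg Subtype.val hgh) x

/-! ### Embedding `ℤⁿ ⋊ Sₙ` in topological full groups -/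

theorem exists_isClopen_disjoint_images [CompactSpace X] [T2Space X] [TotallyDisconnectedSpace X]
    {φ : X ≃ₜ X} (hfree : ∀ (k : ℤ) x, (φ ^ k) x = x → k = 0) (x : X) (n : ℕ) :
    ∃ U : Set X, IsClopen U ∧ x ∈ U ∧
      ∀ m ∈ Set.Ioo (-n : ℤ) n, m ≠ 0 → ∀ u ∈ U, (φ ^ m) u ∉ U := by
  have h : ∀ᶠ V in (𝓝 x).smallSets, ∀ m ∈ Set.Ioo (-n : ℤ) n, m ≠ 0 → ∀ u ∈ V, (φ ^ m) u ∉ V := by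
    rw [Filter.eventually_all_finite (Set.finite_Ioo _ _)]
    intro m _
    by_cases hm : m = 0
    · exact Filter.Eventually.of_forall fun V h => (h hm).elim
    obtain ⟨A, B, hA, hB, hxA, hxB, hAB⟩ := t2_separation (fun h => hm (hfree m x h.symm))
    refine Filter.eventually_smallSets.2 ⟨A ∩ (φ ^ m) ⁻¹' B, Filter.inter_mem (hA.mem_nhds hxA)
      ((φ ^ m).continuous.continuousAt (hB.mem_nhds hxB)), fun V hV _ u hu hu2 => ?_⟩
    exact Set.disjoint_left.1 hAB (hV hu2).1 (hV hu).2
  obtain ⟨W, hW, hW2⟩ := Filter.eventually_smallSets.1 h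
  obtain ⟨O, hOW, hO, hxO⟩ := mem_nhds_iff.1 hW
  obtain ⟨U, hU, hxU, hUO⟩ := compact_exists_isClopen_in_isOpen hO hxO
  exact ⟨U, hU, hxU, hW2 U (hUO.trans hOW)⟩

/-- By minimality the translates of `U` cover the space, and by compactness finitely many suffice.
-/
theorem IsMinimalSystem.exists_bounded_return [CompactSpace X] {φ : X ≃ₜ X}
    (hφ : IsMinimalSystem φ) {U : Set X} (hU : IsOpen U) (hne : U.Nonempty) :
    ∃ N : ℕ, ∀ x, ∃ k : ℤ, |k| ≤ N ∧ (φ ^ k) x ∈ U := by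
  obtain ⟨t, ht⟩ := isCompact_univ.elim_finite_subcover (fun k : ℤ => (φ ^ k) ⁻¹' U)
    (fun k => hU.preimage (φ ^ k).continuous) fun x _ => by
      obtain ⟨_, hz, k, rfl⟩ := (hφ.2 x).inter_open_nonempty U hU hne
      exact Set.mem_iUnion.2 ⟨k, hz⟩
  refine ⟨∑ k ∈ t, k.natAbs, fun x => ?_⟩
  obtain ⟨k, hk⟩ := Set.mem_iUnion.1 (ht (Set.mem_univ x))
  obtain ⟨hkt, hkU⟩ := Set.mem_iUnion.1 hk
  refine ⟨k, ?_, hkU⟩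
  have := Finset.single_le_sum (f := Int.natAbs) (fun _ _ => Nat.zero_le _) hkt
  rw [Int.abs_eq_natAbs]
  exact_mod_cast this

theorem IsMinimalSystem.recurrent [CompactSpace X] {φ : X ≃ₜ X} (hφ : IsMinimalSystem φ)
    {U : Set X} (hU : IsOpen U) (hne : U.Nonempty) : Recurrent φ U ∧ Recurrent φ⁻¹ U := by
  obtain ⟨N, hN⟩ := hφ.exists_bounded_return hU hne
  constructor
  · intro x
    -- Moving ahead by `N + 1` turns a return with exponent of absolute value at most `N` into one
    -- at a positive time.
    obtain ⟨k, hk, h⟩ := hN ((φ ^ (N + 1 : ℤ)) x)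
    rw [abs_le] at hk
    rw [← Homeomorph.mul_apply, ← zpow_add] at h
    refine ⟨(k + (N + 1)).toNat, by omega, ?_⟩
    rwa [← zpow_natCast, Int.toNat_of_nonneg (by omega)]
  · intro x
    obtain ⟨k, hk, h⟩ := hN ((φ ^ (-(N + 1) : ℤ)) x)
    rw [abs_le] at hk
    rw [← Homeomorph.mul_apply, ← zpow_add] at h
    refine ⟨(-(k + -(N + 1))).toNat, by omega, ?_⟩
    rwa [← zpow_natCast, Int.toNat_of_nonneg (by omega), inv_zpow', neg_neg]

/-- The disjoint sets `φ ^ i (U)`, `i < n`, are a copy of `Fin n × U`. The tower action over the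
first return map is transported to their union and extended by the identity. -/
theorem IsMinimalSystem.exists_intWreath_embedding [CompactSpace X] [T2Space X]
    [TotallyDisconnectedSpace X] [Infinite X] {φ : X ≃ₜ X} (hφ : IsMinimalSystem φ) (n : ℕ) :
    ∃ j : IntWreath n →* fullGroup φ, Function.Injective j := by
  classical
  have hfree : ∀ (k : ℤ) x, (φ ^ k) x = x → k = 0 := fun k x => hφ.zpow_apply_eq_self
  obtain ⟨x₀⟩ := hφ.1
  obtain ⟨U, hU, hxU, hdis⟩ := exists_isClopen_disjoint_images hfree x₀ n
  obtain ⟨h, h'⟩ := hφ.recurrent hU.2 ⟨x₀, hxU⟩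
  have : Nonempty U := ⟨⟨x₀, hxU⟩⟩
  let f : Fin n × U → X := fun p => (φ ^ (p.1 : ℤ)) p.2
  have hf : Function.Injective f := by
    rintro ⟨i, u⟩ ⟨j, v⟩ huv
    change (φ ^ (i : ℤ)) (u : X) = (φ ^ (j : ℤ)) v at huv
    have h1 : (φ ^ (-(j : ℤ) + i)) (u : X) = v := by
      rw [zpow_add, Homeomorph.mul_apply, huv, ← Homeomorph.mul_apply, zpow_neg, inv_mul_cancel,
        Homeomorph.one_apply]
    have h2 : (-(j : ℤ) + i) = 0 := by
      by_contra hne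
      exact hdis _ ⟨by omega, by omega⟩ hne u u.2 (h1 ▸ v.2)
    obtain rfl : i = j := Fin.ext (by omega)
    rw [h2, zpow_zero, Homeomorph.one_apply] at h1
    rw [Subtype.ext h1]
  let e : Fin n × U ≃ {x // x ∈ Set.range f} := Equiv.ofInjective f hf
  refine exists_hom_fullGroup hfree
    (j := (Equiv.Perm.extendDomainHom e).comp (towerAct (firstReturn h h') n)) (fun g x => ?_)
    ((Equiv.Perm.extendDomainHom_injective e).comp
      (towerAct_injective (firstReturn_free h h' hfree) n))
  change ∃ k : ℤ, ∀ᶠ z in 𝓝 x, (towerAct (firstReturn h h') n g).extendDomain e z = _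
  by_cases hx : x ∈ Set.range f
  · obtain ⟨⟨i, u⟩, rfl⟩ := hx
    obtain ⟨k, hk⟩ := locallyPower_firstReturn_zpow hU h h' (g.left (g.right i)).toAdd u
    have hnhds : 𝓝 (f (i, u)) = Filter.map (fun v : U => f (i, v)) (𝓝 u) :=
      (((φ ^ (i : ℤ)).isOpenEmbedding.comp hU.2.isOpenEmbedding_subtypeVal).map_nhds_eq u).symm
    -- Descend from floor `i` to `U`, apply the local power `k` of the return map, ascend to floor
    -- `g.right i`.
    refine ⟨(g.right i : ℤ) + k - i, ?_⟩
    rw [hnhds, Filter.eventually_map]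
    filter_upwards [hk] with v hv
    have h1 := Equiv.Perm.extendDomain_apply_image (towerAct (firstReturn h h') n g) e (i, v)
    change (towerAct (firstReturn h h') n g).extendDomain e (f (i, v)) = f _ at h1
    rw [h1, towerAct_apply]
    change (φ ^ (g.right i : ℤ)) (Subtype.val _) = (φ ^ _) ((φ ^ (i : ℤ)) (v : X))
    rw [hv, ← Homeomorph.mul_apply, ← Homeomorph.mul_apply, ← zpow_add, ← zpow_add,
      sub_add_cancel]
  · have hclosed : IsClosed (Set.range f) := by
      have : Set.range f = ⋃ i : Fin n, (φ ^ (i : ℤ)) '' U := by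
        ext z
        simp [f]
      rw [this]
      exact isClosed_iUnion_of_finite fun i => (φ ^ (i : ℤ)).isClosedMap _ hU.1
    refine ⟨0, ?_⟩
    filter_upwards [hclosed.isOpen_compl.mem_nhds hx] with z hz
    rw [Equiv.Perm.extendDomain_apply_not_subtype _ _ hz]
    rfl

end FirstReturn

/-! ### Periodic lines and the eventually constant case -/

/-- Division with remainder by `M`. -/
def quotRemEquiv (M : ℕ) [NeZero M] : Fin M × ℤ ≃ ℤ :=
  (Equiv.prodComm _ _).trans (Int.divModEquiv M).symm

theorem quotRemEquiv_apply {M : ℕ} [NeZero M] (i : Fin M) (k : ℤ) :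
    quotRemEquiv M (i, k) = k * M + i := rfl

theorem apply_add_mul {p : Equiv.Perm ℤ} {M : ℤ} (hp : ∀ n, p (n + M) = p n + M) (k n : ℤ) :
    p (n + k * M) = p n + k * M := by
  induction k with
  | zero => simp
  | succ k ih => rw [add_mul, one_mul, ← add_assoc, hp, ih, add_assoc]
  | pred k ih =>
    have := hp (n + (-k - 1) * M)
    rw [show n + (-k - 1) * M + M = n + -k * M by ring, ih] at this
    linarith

theorem addRight_one_zpow_apply (k n : ℤ) : (Equiv.addRight (1 : ℤ) ^ k) n = n + k := by
  simp

/-- A permutation of `ℤ` that commutes with the translation by `M` comes from `ℤᴹ ⋊ S_M`. -/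
theorem exists_towerAct_eq {M : ℕ} [NeZero M] {p : Equiv.Perm ℤ}
    (hp : ∀ n, p (n + M) = p n + M) :
    ∃ g : IntWreath M, (quotRemEquiv M).permCongrHom (towerAct (Equiv.addRight (1 : ℤ)) M g) = p := by
  let f : Fin M → Fin M × ℤ := fun i => (quotRemEquiv M).symm (p i)
  have hf : ∀ i : Fin M, p i = (f i).2 * M + (f i).1 := fun i =>
    ((quotRemEquiv M).apply_symm_apply (p i)).symm
  -- If `p i` and `p j` had the same remainder, `p i` would be the image of a translate of `j` by a
  -- multiple of `M`, so `i` and `j` would be congruent.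
  have hinj : Function.Injective fun i => (f i).1 := by
    intro i j hij
    have h1 : p i = p (j + ((f i).2 - (f j).2) * M) := by
      rw [apply_add_mul hp, hf i, hf j]
      simp only at hij
      rw [hij]
      ring
    have h2 := p.injective h1
    rw [← add_comm ((_ : ℤ) * _), ← quotRemEquiv_apply j] at h2
    have h3 : (i : ℤ) = quotRemEquiv M (i, 0) := by simp [quotRemEquiv_apply]
    rw [h3] at h2
    exact congrArg Prod.fst ((quotRemEquiv M).injective h2)
  let σ : Equiv.Perm (Fin M) := Equiv.ofBijective _ (Finite.injective_iff_bijective.1 hinj)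
  have hσ : ∀ i, σ i = (f i).1 := fun i => rfl
  refine ⟨⟨fun i => Multiplicative.ofAdd (f (σ.symm i)).2, σ⟩, Equiv.ext fun n => ?_⟩
  obtain ⟨⟨i, k⟩, rfl⟩ := (quotRemEquiv M).surjective n
  rw [Equiv.permCongrHom_coe, Equiv.permCongr_apply, Equiv.symm_apply_apply, towerAct_apply]
  simp only [Equiv.symm_apply_apply, toAdd_ofAdd, addRight_one_zpow_apply]
  rw [quotRemEquiv_apply, quotRemEquiv_apply, add_comm ((k : ℤ) * M), apply_add_mul hp, hf, hσ]
  ring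

theorem vertexAct_add_period {x : ℤ → Block} (hx : Alternating x) {M : ℤ}
    (hM : ∀ n, x (n + M) = x n) (w : FreeGroup Gen) (n : ℤ) :
    vertexAct hx w (n + M) = vertexAct hx w n + M := by
  obtain ⟨L, -, hL⟩ := vertexAct_local w
  have := hL x x hx hx (n + M) n fun j _ => by rw [add_right_comm, hM]
  omega

theorem exists_intWreath_embedding_of_eventuallyConstant {ω : Omega} (hω : EventuallyConstant ω) :
    ∃ (n : ℕ) (j : grigorchukGroup ω →* IntWreath n), Function.Injective j := by
  obtain ⟨N, hN⟩ := hω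
  have hx := toeplitz_alternating ω (ω N)
  have hper : ∀ w n, vertexAct hx w (n + (2 ^ (N + 1) : ℕ)) =
      vertexAct hx w n + (2 ^ (N + 1) : ℕ) :=
    vertexAct_add_period hx fun n => by
      push_cast
      exact toeplitz_periodic hN n
  choose g hg using fun s => exists_towerAct_eq (hper (FreeGroup.of s))
  have hT : ∀ (k u : ℤ), (Equiv.addRight (1 : ℤ) ^ k) u = u → k = 0 := fun k u h => by
    simpa using h
  have hcomp : ((quotRemEquiv (2 ^ (N + 1))).permCongrHom.toMonoidHom.comp
      (towerAct (Equiv.addRight (1 : ℤ)) _)).comp (FreeGroup.lift g) = vertexAct hx := by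
    ext1 s
    simpa using hg s
  have hinj : Function.Injective ((quotRemEquiv (2 ^ (N + 1))).permCongrHom.toMonoidHom.comp
      (towerAct (Equiv.addRight (1 : ℤ)) _)) :=
    (quotRemEquiv (2 ^ (N + 1))).permCongrHom.injective.comp (towerAct_injective hT _)
  obtain ⟨ι, hι, -⟩ := exists_injective_hom_of_ker ω (FreeGroup.lift g) fun w => by
    rw [← map_eq_one_iff _ hinj, ← MonoidHom.comp_apply, hcomp, treeAct_eq_one_iff ω (ω N)]
    constructor
    · rintro ⟨B, hB⟩
      refine Equiv.ext fun n => ?_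
      -- Adding `B + |n|` periods brings `n` beyond `B`; commuting with the period carries the fixed
      -- point back to `n`.
      have h1 := hB (n + (B + n.natAbs : ℕ) * (2 ^ (N + 1) : ℕ)) (by
        have : (1 : ℤ) ≤ (2 ^ (N + 1) : ℕ) := by exact_mod_cast Nat.one_le_two_pow
        have := le_mul_of_one_le_right (Int.natCast_nonneg (B + n.natAbs)) this
        omega)
      rw [apply_add_mul (hper w)] at h1
      exact add_right_cancel h1
    · intro h
      exact ⟨0, fun n _ => by rw [h]; rfl⟩
  exact ⟨_, ι, hι⟩

/-! ### An auxiliary infinite minimal subshift and the assembly -/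

theorem not_eventuallyConstant_mod_two :
    ¬ EventuallyConstant fun n => if n % 2 = 0 then 0 else 1 := by
  rintro ⟨N, hN⟩
  have h := hN (N + 1) (Nat.le_succ N)
  rcases Nat.mod_two_eq_zero_or_one N with h1 | h1
  · simp [h1, show (N + 1) % 2 = 1 by omega] at h
  · simp [h1, show (N + 1) % 2 = 0 by omega] at h

theorem exists_infinite_minimal_subshift :
    ∃ Y : Subshift Block, Y.carrier.Infinite ∧ IsMinimalSystem Y.map := by
  obtain ⟨Y, -, hY, hmin, -⟩ := exists_subshift_embedding not_eventuallyConstant_mod_two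
  exact ⟨Y, hY, hmin⟩

theorem exists_embedding_of_eventuallyConstant {ω : Omega} (hω : EventuallyConstant ω)
    {X : Type*} [TopologicalSpace X] [CompactSpace X] [T2Space X] [TotallyDisconnectedSpace X]
    [Infinite X] {φ : X ≃ₜ X} (hφ : IsMinimalSystem φ) :
    ∃ ι : grigorchukGroup ω →* fullGroup φ, Function.Injective ι := by
  obtain ⟨n, j, hj⟩ := exists_intWreath_embedding_of_eventuallyConstant hω
  obtain ⟨k, hk⟩ := hφ.exists_intWreath_embedding n
  exact ⟨k.comp j, hk.comp hj⟩

theorem exists_minimal_subshift_embedding (ω : Omega) :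
    ∃ Y : Subshift Block, Y.carrier.Infinite ∧ IsMinimalSystem Y.map ∧
      ∃ ι : grigorchukGroup ω →* fullGroup Y.map, Function.Injective ι := by
  by_cases hω : EventuallyConstant ω
  · obtain ⟨Y, hY, hmin⟩ := exists_infinite_minimal_subshift
    have : Infinite Y.carrier := hY.to_subtype
    have : CompactSpace Y.carrier := isCompact_iff_compactSpace.1 Y.isClosed.isCompact
    exact ⟨Y, hY, hmin, exists_embedding_of_eventuallyConstant hω hmin⟩
  · obtain ⟨Y, -, hY, hmin, ι, hι, -⟩ := exists_subshift_embedding hω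
    exact ⟨Y, hY, hmin, ι, hι⟩

end GrigorchukFullGroup

theorem theorem1 :
    -- every Grigorchuk group embeds in the full group of an infinite minimal subshift
    (∀ ω : Omega, ∃ (A : Type) (_ : Finite A) (_ : TopologicalSpace A) (_ : DiscreteTopology A)
      (Y : Subshift A), Y.carrier.Infinite ∧ IsMinimalSystem Y.map ∧
        ∃ ι : grigorchukGroup ω →* fullGroup Y.map, Function.Injective ι) ∧
    -- the eventually constant case
    (∀ ω : Omega, EventuallyConstant ω →
      (∃ (n : ℕ) (j : grigorchukGroup ω →* IntWreath n), Function.Injective j) ∧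
      ∀ (X : Type*) [TopologicalSpace X] (φ : X ≃ₜ X), IsCantorMinimal φ →
        (∀ n : ℕ, ∃ j : IntWreath n →* fullGroup φ, Function.Injective j) ∧
        ∃ ι : grigorchukGroup ω →* fullGroup φ, Function.Injective ι) ∧
    -- the other case
    (∀ ω : Omega, ¬ EventuallyConstant ω →
      (∃ y, ExtendsSchreierGraph ω y) ∧
      (∀ y, ExtendsSchreierGraph ω y →
        subshiftSet ω =
          {x | MapClusterPt x Filter.atTop fun n : ℕ => (shift Block ^ n) y}) ∧
      ∃ Y : Subshift Block, Y.carrier = subshiftSet ω ∧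
        Y.carrier.Infinite ∧ IsMinimalSystem Y.map ∧
        ∃ ι : grigorchukGroup ω →* fullGroup Y.map, Function.Injective ι ∧
          ∀ (s : Gen) (x : Y.carrier),
            (∃! m : ℤ, (blockGraph x).Adj s 0 m) ∧
            ((blockGraph x).Adj s 0 1 → (ι (gen ω s)).1 x = Y.map x) ∧
            ((blockGraph x).Adj s 0 (-1) → (ι (gen ω s)).1 x = Y.map.symm x) ∧
            ((blockGraph x).Adj s 0 0 → (ι (gen ω s)).1 x = x)) := by
  refine ⟨fun ω => ?_, fun ω hω => ⟨exists_intWreath_embedding_of_eventuallyConstant hω,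
    fun X _ φ hφ => ?_⟩, fun ω hω => ⟨⟨_, toeplitz_extendsSchreierGraph ω 0⟩, fun y hy => ?_,
    exists_subshift_embedding hω⟩⟩
  · obtain ⟨Y, h⟩ := exists_minimal_subshift_embedding ω
    exact ⟨Block, inferInstance, inferInstance, inferInstance, Y, h⟩
  · obtain ⟨⟨e⟩, hmin⟩ := hφ
    have : CompactSpace X := e.symm.compactSpace
    have : T2Space X := e.symm.t2Space
    have : TotallyDisconnectedSpace X := e.symm.totallyDisconnectedSpace
    have : Infinite X := e.toEquiv.infinite_iff.2 inferInstance
    exact ⟨hmin.exists_intWreath_embedding, exists_embedding_of_eventuallyConstant hω hmin⟩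
  · rw [subshiftSet_eq ω 0, toeplitzSet_eq_setOf_mapClusterPt hy]
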